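/- Let $\Bbbk$ be an algebraically closed field and let $A$ be the path algebra over $\Bbbk$ of the quiver $1\overset{\alpha}{\to}2\overset{\beta}{\to}3$ modulo the relation $\beta\alpha=0$, with primitive idempotents $e_1,e_2,e_3$ (so $e_2\alpha=\alpha=\alpha e_1$ and $e_3\beta=\beta=\beta e_2$). Let $\mathcal{C}$ be a category equivalent to the category of finite dimensional left $A$-modules, and let $\mathscr{C}_A$ be the $2$-category with one object $\mathcal{C}$, whose $1$-morphisms are the endofunctors of $\mathcal{C}$ isomorphic to tensoring over $A$ with a bimodule from the additive closure of ${}_AA_A$ and ${}_AA\otimes_{\Bbbk}A_A$, and whose $2$-morphisms are all natural transformations. For $i,j\in\{1,2,3\}$ let $\mathrm{F}_{ij}$ be a $1$-morphism given by tensoring with $Ae_i\otimes_{\Bbbk} e_jA$, and let $\mathrm{F}=\bigoplus_{i,j}\mathrm{F}_{ij}$. Let $\mathbf{M}$ be a finitary $2$-representation of $\mathscr{C}_A$, that is, a $\Bbbk$-linear action of $\mathscr{C}_A$ by $\Bbbk$-linear functors (strict, or more generally respecting compositions and identities up to coherent isomorphism) on an additive, idempotent split, Krull-Schmidt, $\Bbbk$-linear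 category with finitely many isomorphism classes of indecomposable objects and finite dimensional morphism spaces. Assume that $\mathbf{M}$ is transitive (for all indecomposable objects $X,Y$ there is a $1$-morphism $\mathrm{G}$ such that $Y$ is isomorphic to a direct summand of $\mathbf{M}(\mathrm{G})X$), simple (the underlying category has no non-zero proper ideals invariant under the action) and faithful (non-zero $2$-morphisms act by non-zero natural transformations). Let $X_1,\dots,X_n$ be a complete and irredundant list of representatives of the isomorphism classes of indecomposable objects and, for a $1$-morphism $\mathrm{G}$, let $[\mathrm{G}]$ be the matrix whose $(r,s)$-entry is the multiplicity of $X_r$ as a direct summand of $\mathbf{M}(\mathrm{G})X_s$. Then $n=3$ and, after a suitable reordering of $X_1,X_2,X_3$ (that is, up to simultaneous conjugation of all the matrices by one permutation matrix), $$[\mathrm{F}]=N_{13}:=\begin{pmatrix}2&2&1\\2&2&1\\2&2&1\end{pmatrix}$$ and the matrices $M_{ij}=[\mathrm{F}_{ij}]$, arranged as a $3\times 3$ array with $M_{ij}$ in row $i$ and column $j$, are $$\begin{pmatrix}1&0&0\\0&0&0\\0&0&0\end{pmatrix},\quad\begin{pmatrix}1&1&0\\0&0&0\\0&0&0\end{pmatrix},\quad\begin{pmatrix}0&1&1\\0&0&0\\0&0&0\end{pmatrix},$$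 $$\begin{pmatrix}0&0&0\\1&0&0\\0&0&0\end{pmatrix},\quad\begin{pmatrix}0&0&0\\1&1&0\\0&0&0\end{pmatrix},\quad\begin{pmatrix}0&0&0\\0&1&1\\0&0&0\end{pmatrix},$$ $$\begin{pmatrix}0&0&0\\0&0&0\\1&0&0\end{pmatrix},\quad\begin{pmatrix}0&0&0\\0&0&0\\1&1&0\end{pmatrix},\quad\begin{pmatrix}0&0&0\\0&0&0\\0&1&1\end{pmatrix}.$$ -/

import Mathlib

open CategoryTheory CategoryTheory.Limits MulOpposite
open scoped TensorProduct

universe w v v₁ u₁ u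

set_option linter.unusedSectionVars false

-- Composition of endofunctors as a monoidal structure; biproducts of pairs from finite ones.
attribute [local instance] endofunctorMonoidalCategory hasBinaryBiproducts_of_finite_biproducts

noncomputable section

namespace ProjFun

section Bimodules

variable (A : Type u) [Ring A]

/-- An `A`-`A`-bimodule: a left and a right module structure (the latter written as a module over
the opposite ring, `op a • x = x a`) which commute with each other. -/
structure Bimodule where
  carrier : Type u
  [grp : AddCommGroup carrier]
  [left : Module A carrier]
  [right : Module Aᵐᵒᵖ carrier]
  [comm : SMulCommClass A Aᵐᵒᵖ carrier]

attribute [instance] Bimodule.grp Bimodule.left Bimodule.right Bimodule.comm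

/-- Homomorphisms of bimodules. -/
structure BimHom (X Y : Type*) [AddCommGroup X] [Module A X] [Module Aᵐᵒᵖ X]
    [AddCommGroup Y] [Module A Y] [Module Aᵐᵒᵖ Y] where
  toLin : X →ₗ[A] Y
  map_right : ∀ (a : A) (x : X), toLin (op a • x) = op a • toLin x

section BalTensor

variable (X : Type*) [AddCommGroup X] [Module A X] [Module Aᵐᵒᵖ X] [SMulCommClass A Aᵐᵒᵖ X]
variable (N : Type*) [AddCommGroup N] [Module A N]

/-- The relations `x a ⊗ n = x ⊗ a n` inside the tensor product over `ℤ`. -/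
def balRel : Submodule A (X ⊗[ℤ] N) :=
  Submodule.span A {t | ∃ (x : X) (a : A) (n : N), (op a • x) ⊗ₜ[ℤ] n - x ⊗ₜ[ℤ] (a • n) = t}

/-- The tensor product `X ⊗_A N` of a bimodule with a left module, a left module. -/
def BalTensor : Type _ := (X ⊗[ℤ] N) ⧸ balRel A X N

instance : AddCommGroup (BalTensor A X N) :=
  inferInstanceAs (AddCommGroup ((X ⊗[ℤ] N) ⧸ balRel A X N))

instance : Module A (BalTensor A X N) :=
  inferInstanceAs (Module A ((X ⊗[ℤ] N) ⧸ balRel A X N))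

namespace BalTensor

variable {X N}

variable (X N) in
/-- The projection from the tensor product over `ℤ`. -/
def mk : (X ⊗[ℤ] N) →ₗ[A] BalTensor A X N := (balRel A X N).mkQ

/-- The pure tensor `x ⊗ n` in `X ⊗_A N`. -/
def tmul (x : X) (n : N) : BalTensor A X N := mk A X N (x ⊗ₜ[ℤ] n)

variable {A}

theorem tmul_add (x : X) (n n' : N) : tmul A x (n + n') = tmul A x n + tmul A x n' := by
  rw [tmul, TensorProduct.tmul_add, map_add]; rfl

theorem add_tmul (x x' : X) (n : N) : tmul A (x + x') n = tmul A x n + tmul A x' n := by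
  rw [tmul, TensorProduct.add_tmul, map_add]; rfl

theorem tmul_zero (x : X) : tmul A x (0 : N) = 0 := by
  rw [tmul, TensorProduct.tmul_zero, map_zero]

theorem zero_tmul (n : N) : tmul A (0 : X) n = 0 := by
  rw [tmul, TensorProduct.zero_tmul, map_zero]

/-- The pure tensor as a biadditive map. -/
def tmulHom (A : Type u) [Ring A] (X : Type*) [AddCommGroup X] [Module A X] [Module Aᵐᵒᵖ X]
    [SMulCommClass A Aᵐᵒᵖ X] (N : Type*) [AddCommGroup N] [Module A N] :
    X →+ N →+ BalTensor A X N :=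
  AddMonoidHom.mk' (fun x => AddMonoidHom.mk' (tmul A x) (tmul_add x))
    (fun x x' => AddMonoidHom.ext (add_tmul x x'))

@[simp] theorem tmulHom_apply (x : X) (n : N) : tmulHom A X N x n = tmul A x n := rfl

theorem smul_tmul (a : A) (x : X) (n : N) : tmul A (a • x) n = a • tmul A x n := by
  rw [tmul, tmul, ← map_smul, TensorProduct.smul_tmul']

theorem op_smul_tmul (a : A) (x : X) (n : N) : tmul A (op a • x) n = tmul A x (a • n) := by
  rw [← sub_eq_zero, tmul, tmul, ← map_sub]
  exact (Submodule.Quotient.mk_eq_zero _).2 (Submodule.subset_span ⟨x, a, n, rfl⟩)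

@[elab_as_elim]
theorem induction {p : BalTensor A X N → Prop} (h0 : p 0) (h1 : ∀ x n, p (tmul A x n))
    (h2 : ∀ s t, p s → p t → p (s + t)) (t : BalTensor A X N) : p t := by
  obtain ⟨s, rfl⟩ : ∃ s, mk A X N s = t := (balRel A X N).mkQ_surjective t
  induction s with
  | zero => rw [map_zero]; exact h0
  | tmul x n => exact h1 x n
  | add s t hs ht => rw [map_add]; exact h2 _ _ hs ht

section

variable {P : Type*} [AddCommGroup P]

/-- The universal property of `X ⊗_A N` for additive maps. -/
def liftAdd (f : X →+ N →+ P) (hb : ∀ x (a : A) n, f (op a • x) n = f x (a • n)) :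
    BalTensor A X N →+ P :=
  QuotientAddGroup.lift (balRel A X N).toAddSubgroup
    (TensorProduct.liftAddHom f (fun r m n => by simp)) (by
      intro t ht
      have key : ∀ b : A, TensorProduct.liftAddHom f (fun r m n => by simp) (b • t) = 0 := by
        refine Submodule.span_induction ?_ ?_ ?_ ?_ ht
        · rintro _ ⟨x, a, n, rfl⟩ b
          simp [smul_sub, TensorProduct.smul_tmul', ← hb, smul_comm b (op a) x]
        · simp
        · intro s t _ _ hs ht b
          rw [smul_add, map_add, hs, ht, add_zero]
        · intro c t _ ht b
          rw [smul_smul, ht]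
      simpa using key 1)

@[simp] theorem liftAdd_tmul (f : X →+ N →+ P)
    (hb : ∀ x (a : A) n, f (op a • x) n = f x (a • n)) (x : X) (n : N) :
    liftAdd f hb (tmul A x n) = f x n := rfl

theorem addHom_ext {f g : BalTensor A X N →+ P}
    (h : ∀ x n, f (tmul A x n) = g (tmul A x n)) : f = g := by
  ext t
  induction t using induction with
  | h0 => simp
  | h1 x n => exact h x n
  | h2 s t hs ht => simp [hs, ht]

end

variable {P : Type*} [AddCommGroup P] [Module A P]

/-- The universal property of `X ⊗_A N` for `A`-linear maps. -/
def lift (f : X →+ N →+ P) (hl : ∀ (b : A) x n, f (b • x) n = b • f x n)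
    (hb : ∀ x (a : A) n, f (op a • x) n = f x (a • n)) : BalTensor A X N →ₗ[A] P :=
  { liftAdd f hb with
    map_smul' := fun b t => by
      change liftAdd f hb (b • t) = b • liftAdd f hb t
      induction t using induction with
      | h0 => simp
      | h1 x n => rw [← smul_tmul, liftAdd_tmul, liftAdd_tmul, hl]
      | h2 s t hs ht => simp only [smul_add, map_add, hs, ht] }

@[simp] theorem lift_tmul (f : X →+ N →+ P) (hl : ∀ (b : A) x n, f (b • x) n = b • f x n)
    (hb : ∀ x (a : A) n, f (op a • x) n = f x (a • n)) (x : X) (n : N) :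
    lift f hl hb (tmul A x n) = f x n := rfl

theorem hom_ext {f g : BalTensor A X N →ₗ[A] P}
    (h : ∀ x n, f (tmul A x n) = g (tmul A x n)) : f = g := by
  ext t
  induction t using induction with
  | h0 => simp
  | h1 x n => exact h x n
  | h2 s t hs ht => simp [hs, ht]

variable {Y : Type*} [AddCommGroup Y] [Module A Y] [Module Aᵐᵒᵖ Y] [SMulCommClass A Aᵐᵒᵖ Y]
variable {N' : Type*} [AddCommGroup N'] [Module A N']

/-- Functoriality of `X ⊗_A N` in both arguments. -/
def map (f : BimHom A X Y) (g : N →ₗ[A] N') : BalTensor A X N →ₗ[A] BalTensor A Y N' :=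
  lift (AddMonoidHom.mk' (fun x => AddMonoidHom.mk' (fun n => tmul A (f.toLin x) (g n))
      (fun n n' => by rw [map_add, tmul_add]))
      (fun x x' => by ext n; simp [add_tmul]))
    (fun b x n => by simp [smul_tmul])
    (fun x a n => by simp [f.map_right, op_smul_tmul])

@[simp] theorem map_tmul (f : BimHom A X Y) (g : N →ₗ[A] N') (x : X) (n : N) :
    map f g (tmul A x n) = tmul A (f.toLin x) (g n) := rfl

end BalTensor

end BalTensor

/-- The identity homomorphism of a bimodule. -/
def BimHom.id (X : Type*) [AddCommGroup X] [Module A X] [Module Aᵐᵒᵖ X] : BimHom A X X :=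
  ⟨LinearMap.id, fun _ _ => rfl⟩

variable {A}

/-- The functor `X ⊗_A -` on left `A`-modules. -/
def tensorFunctor (X : Bimodule A) : ModuleCat.{u} A ⥤ ModuleCat.{u} A where
  obj N := ModuleCat.of A (BalTensor A X.carrier N)
  map f := ModuleCat.ofHom (BalTensor.map (BimHom.id A X.carrier) f.hom)
  map_id N := by
    ext1
    exact BalTensor.hom_ext fun x n => rfl
  map_comp f g := by
    ext1
    exact BalTensor.hom_ext fun x n => rfl

end Bimodules

section Outer

variable (k : Type*) [Field k] (A : Type u) [Ring A] [Algebra k A]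
variable (L : Type*) [AddCommGroup L] [Module k L] [Module A L] [IsScalarTower k A L]
variable (R : Type*) [AddCommGroup R] [Module k R] [Module Aᵐᵒᵖ R] [IsScalarTower k Aᵐᵒᵖ R]

/-- The tensor product `L ⊗_k R` of a left module `L` and a right module `R`, as a bimodule:
`a (l ⊗ r) b = a l ⊗ r b`. -/
def Outer (_A : Type u) (L : Type*) [AddCommGroup L] [Module k L]
    (R : Type*) [AddCommGroup R] [Module k R] : Type _ := L ⊗[k] R

instance : AddCommGroup (Outer k A L R) := inferInstanceAs (AddCommGroup (L ⊗[k] R))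

instance : Module A (Outer k A L R) := inferInstanceAs (Module A (L ⊗[k] R))

instance : Module Aᵐᵒᵖ (Outer k A L R) where
  smul b t := (LinearMap.lTensor L (Algebra.lsmul k k R b) : L ⊗[k] R →ₗ[k] L ⊗[k] R) t
  one_smul t := by
    change (LinearMap.lTensor L (Algebra.lsmul k k R 1) : L ⊗[k] R →ₗ[k] L ⊗[k] R) t = t
    rw [map_one]
    exact congrArg (fun f => f t) (LinearMap.lTensor_id L R)
  mul_smul b c t := by
    change (LinearMap.lTensor L (Algebra.lsmul k k R (b * c)) : L ⊗[k] R →ₗ[k] L ⊗[k] R) t =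
      (LinearMap.lTensor L (Algebra.lsmul k k R b) : L ⊗[k] R →ₗ[k] L ⊗[k] R)
        ((LinearMap.lTensor L (Algebra.lsmul k k R c) : L ⊗[k] R →ₗ[k] L ⊗[k] R) t)
    rw [map_mul]
    exact congrArg (fun f => f t) (LinearMap.lTensor_mul L _ _)
  smul_zero b := map_zero (LinearMap.lTensor L (Algebra.lsmul k k R b))
  smul_add b := map_add (LinearMap.lTensor L (Algebra.lsmul k k R b))
  add_smul b c t := by
    change (LinearMap.lTensor L (Algebra.lsmul k k R (b + c)) : L ⊗[k] R →ₗ[k] L ⊗[k] R) t = _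
    rw [map_add, LinearMap.lTensor_add]
    rfl
  zero_smul t := by
    change (LinearMap.lTensor L (Algebra.lsmul k k R 0) : L ⊗[k] R →ₗ[k] L ⊗[k] R) t = _
    rw [map_zero, LinearMap.lTensor_zero]
    rfl

variable {L R}

/-- The pure tensor `l ⊗ r`. -/
def Outer.tmul (l : L) (r : R) : Outer k A L R := l ⊗ₜ[k] r

theorem Outer.tmul_add (l : L) (r r' : R) :
    Outer.tmul k A l (r + r') = Outer.tmul k A l r + Outer.tmul k A l r' :=
  TensorProduct.tmul_add l r r'

theorem Outer.add_tmul (l l' : L) (r : R) :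
    Outer.tmul k A (l + l') r = Outer.tmul k A l r + Outer.tmul k A l' r :=
  TensorProduct.add_tmul l l' r

theorem Outer.smul_tmul_comm (c : k) (l : L) (r : R) :
    Outer.tmul k A (c • l) r = Outer.tmul k A l (c • r) :=
  TensorProduct.smul_tmul c l r

@[simp] theorem Outer.smul_tmul (a : A) (l : L) (r : R) :
    a • Outer.tmul k A l r = Outer.tmul k A (a • l) r := rfl

@[simp] theorem Outer.op_smul_tmul (b : Aᵐᵒᵖ) (l : L) (r : R) :
    b • Outer.tmul k A l r = Outer.tmul k A l (b • r) := rfl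

@[elab_as_elim]
theorem Outer.induction {p : Outer k A L R → Prop} (h0 : p 0) (h1 : ∀ l r, p (Outer.tmul k A l r))
    (h2 : ∀ s t, p s → p t → p (s + t)) (t : Outer k A L R) : p t :=
  TensorProduct.induction_on (motive := p) t h0 h1 h2

instance : SMulCommClass A Aᵐᵒᵖ (Outer k A L R) where
  smul_comm a b t := by
    induction t using Outer.induction with
    | h0 => simp only [smul_zero]
    | h1 l r => rfl
    | h2 s t hs ht => simp only [smul_add, hs, ht]

variable (L R)

/-- `L ⊗_k R` as a bundled bimodule. -/
def outer (L : Type u) [AddCommGroup L] [Module k L] [Module A L] [IsScalarTower k A L]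
    (R : Type u) [AddCommGroup R] [Module k R] [Module Aᵐᵒᵖ R] [IsScalarTower k Aᵐᵒᵖ R] :
    Bimodule A := ⟨Outer k A L R⟩

/-- A bimodule in the additive closure of `A` and `A ⊗_k A`: a direct summand of a finite direct
sum of copies of these two bimodules. -/
def InAdd (X : Type*) [AddCommGroup X] [Module A X] [Module Aᵐᵒᵖ X] : Prop :=
  ∃ (n : ℕ) (i : BimHom A X (Fin n → A × Outer k A A A))
    (p : BimHom A (Fin n → A × Outer k A A A) X), ∀ x, p.toLin (i.toLin x) = x

end Outer

section Closure

section Right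

variable {A : Type u} [Ring A]
variable {X Y Z X' Y' : Type*}
variable [AddCommGroup X] [Module A X] [Module Aᵐᵒᵖ X] [SMulCommClass A Aᵐᵒᵖ X]
variable [AddCommGroup Y] [Module A Y] [Module Aᵐᵒᵖ Y] [SMulCommClass A Aᵐᵒᵖ Y]
variable [AddCommGroup Z] [Module A Z] [Module Aᵐᵒᵖ Z] [SMulCommClass A Aᵐᵒᵖ Z]
variable [AddCommGroup X'] [Module A X'] [Module Aᵐᵒᵖ X'] [SMulCommClass A Aᵐᵒᵖ X']
variable [AddCommGroup Y'] [Module A Y'] [Module Aᵐᵒᵖ Y'] [SMulCommClass A Aᵐᵒᵖ Y']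

/-- Right multiplication by an element, as a homomorphism of left modules. -/
def rightAct (X : Type*) [AddCommGroup X] [Module A X] [Module Aᵐᵒᵖ X] [SMulCommClass A Aᵐᵒᵖ X]
    (b : Aᵐᵒᵖ) : X →ₗ[A] X where
  toFun x := b • x
  map_add' := smul_add b
  map_smul' a x := (smul_comm a b x).symm

/-- The right action on `Y ⊗_A X`: `(y ⊗ x) a = y ⊗ x a`. -/
instance : Module Aᵐᵒᵖ (BalTensor A Y X) where
  smul b t := BalTensor.map (BimHom.id A Y) (rightAct X b) t
  one_smul t := by
    change BalTensor.map (BimHom.id A Y) (rightAct X 1) t = t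
    induction t using BalTensor.induction with
    | h0 => simp
    | h1 y x => simp [rightAct, BimHom.id]
    | h2 s t hs ht => simp only [map_add, hs, ht]
  mul_smul b c t := by
    change BalTensor.map (BimHom.id A Y) (rightAct X (b * c)) t =
      BalTensor.map (BimHom.id A Y) (rightAct X b) (BalTensor.map (BimHom.id A Y) (rightAct X c) t)
    induction t using BalTensor.induction with
    | h0 => simp
    | h1 y x => simp [rightAct, BimHom.id, mul_smul]
    | h2 s t hs ht => simp only [map_add, hs, ht]
  smul_zero b := map_zero (BalTensor.map (BimHom.id A Y) (rightAct X b))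
  smul_add b := map_add (BalTensor.map (BimHom.id A Y) (rightAct X b))
  add_smul b c t := by
    change BalTensor.map (BimHom.id A Y) (rightAct X (b + c)) t =
      BalTensor.map (BimHom.id A Y) (rightAct X b) t +
        BalTensor.map (BimHom.id A Y) (rightAct X c) t
    induction t using BalTensor.induction with
    | h0 => simp
    | h1 y x => simp [rightAct, BimHom.id, add_smul, BalTensor.tmul_add]
    | h2 s t hs ht => simp only [map_add, hs, ht]; abel
  zero_smul t := by
    change BalTensor.map (BimHom.id A Y) (rightAct X 0) t = 0
    induction t using BalTensor.induction with
    | h0 => simp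
    | h1 y x => simp [rightAct, BimHom.id, BalTensor.tmul_zero]
    | h2 s t hs ht => simp only [map_add, hs, ht, add_zero]

theorem BalTensor.right_smul_tmul (b : Aᵐᵒᵖ) (y : Y) (x : X) :
    b • BalTensor.tmul A y x = BalTensor.tmul A y (b • x) := rfl

instance : SMulCommClass A Aᵐᵒᵖ (BalTensor A Y X) where
  smul_comm a b t := (map_smul (BalTensor.map (BimHom.id A Y) (rightAct X b)) a t).symm

/-- Composition of homomorphisms of bimodules. -/
def BimHom.comp (g : BimHom A Y Z) (f : BimHom A X Y) : BimHom A X Z :=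
  ⟨g.toLin ∘ₗ f.toLin, fun a x => by simp [f.map_right, g.map_right]⟩

/-- A linear map out of `Y ⊗_A X` respecting the right action on pure tensors. -/
def BimHom.ofTensor (f : BalTensor A Y X →ₗ[A] Z)
    (h : ∀ (a : A) y x, f (BalTensor.tmul A y (op a • x)) = op a • f (BalTensor.tmul A y x)) :
    BimHom A (BalTensor A Y X) Z :=
  ⟨f, fun a t => by
    induction t using BalTensor.induction with
    | h0 => simp
    | h1 y x => rw [BalTensor.right_smul_tmul, h]
    | h2 s t hs ht => simp only [smul_add, map_add, hs, ht]⟩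

/-- The tensor product of homomorphisms of bimodules. -/
def BimHom.tensor (f : BimHom A Y Y') (g : BimHom A X X') :
    BimHom A (BalTensor A Y X) (BalTensor A Y' X') :=
  .ofTensor (BalTensor.map f g.toLin) (fun a y x => by
    simp [g.map_right, BalTensor.right_smul_tmul])

end Right

section Unit

variable {A : Type u} [Ring A] (N : Type*) [AddCommGroup N] [Module A N]

/-- The left unit isomorphism `A ⊗_A N → N`. -/
def unitHom : BalTensor A A N →ₗ[A] N :=
  BalTensor.lift (AddMonoidHom.mk' (fun a => AddMonoidHom.mk' (fun n => a • n) (smul_add a))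
      (fun a b => by ext n; simp [add_smul]))
    (fun b a n => by simp [mul_smul]) (fun x a n => by simp [mul_smul])

/-- The inverse of the left unit isomorphism. -/
def unitInv : N →ₗ[A] BalTensor A A N where
  toFun n := BalTensor.tmul A 1 n
  map_add' := BalTensor.tmul_add 1
  map_smul' a n := by
    rw [← BalTensor.op_smul_tmul, RingHom.id_apply, ← BalTensor.smul_tmul]; simp

theorem unitInv_unitHom (t : BalTensor A A N) : unitInv N (unitHom N t) = t := by
  induction t using BalTensor.induction with
  | h0 => simp
  | h1 a n =>
    change BalTensor.tmul A 1 (a • n) = BalTensor.tmul A a n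
    rw [← BalTensor.op_smul_tmul]; simp
  | h2 s t hs ht => rw [map_add, map_add, hs, ht]

theorem unitHom_unitInv (n : N) : unitHom (A := A) N (unitInv N n) = n := one_smul A n

/-- The bimodule `A` acts as the identity functor. -/
def tensorUnitIso : tensorFunctor (⟨A⟩ : Bimodule A) ≅ 𝟭 (ModuleCat.{u} A) :=
  NatIso.ofComponents
    (fun N => LinearEquiv.toModuleIso
      { unitHom (A := A) N with
        invFun := unitInv N
        left_inv := unitInv_unitHom (N : Type u)
        right_inv := unitHom_unitInv (N : Type u) })
    (fun f => by
      ext1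
      refine BalTensor.hom_ext fun a n => ?_
      exact (map_smul f.hom a n).symm)

end Unit

section Assoc

variable {A : Type u} [Ring A]
variable (Y : Type*) [AddCommGroup Y] [Module A Y] [Module Aᵐᵒᵖ Y] [SMulCommClass A Aᵐᵒᵖ Y]
variable (X : Type*) [AddCommGroup X] [Module A X] [Module Aᵐᵒᵖ X] [SMulCommClass A Aᵐᵒᵖ X]
variable (N : Type*) [AddCommGroup N] [Module A N]

/-- The map `x ⊗ n ↦ (y ⊗ x) ⊗ n`. -/
def assocAux (y : Y) : BalTensor A X N →+ BalTensor A (BalTensor A Y X) N :=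
  BalTensor.liftAdd ((BalTensor.tmulHom A (BalTensor A Y X) N).comp (BalTensor.tmulHom A Y X y))
    (fun x a n => BalTensor.op_smul_tmul a (BalTensor.tmul A y x) n)

theorem assocAux_tmul (y : Y) (x : X) (n : N) : assocAux Y X N y (BalTensor.tmul A x n) =
    BalTensor.tmul A (BalTensor.tmul A y x) n := rfl

/-- The associativity isomorphism `Y ⊗_A (X ⊗_A N) → (Y ⊗_A X) ⊗_A N`. -/
def assocHom : BalTensor A Y (BalTensor A X N) →ₗ[A] BalTensor A (BalTensor A Y X) N :=
  BalTensor.lift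
    (AddMonoidHom.mk' (assocAux Y X N)
      (fun y y' => BalTensor.addHom_ext fun x n => by
        rw [AddMonoidHom.add_apply, assocAux_tmul, assocAux_tmul, assocAux_tmul,
          BalTensor.add_tmul, BalTensor.add_tmul]))
    (fun b y t => by
      change assocAux Y X N (b • y) t = b • assocAux Y X N y t
      induction t using BalTensor.induction with
      | h0 => rw [map_zero, map_zero, smul_zero]
      | h1 x n => rw [assocAux_tmul, assocAux_tmul, BalTensor.smul_tmul, BalTensor.smul_tmul]
      | h2 s t hs ht => rw [map_add, map_add, smul_add, hs, ht])
    (fun y a t => by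
      change assocAux Y X N (op a • y) t = assocAux Y X N y (a • t)
      induction t using BalTensor.induction with
      | h0 => rw [smul_zero, map_zero, map_zero]
      | h1 x n =>
        rw [← BalTensor.smul_tmul, assocAux_tmul, assocAux_tmul, BalTensor.op_smul_tmul]
      | h2 s t hs ht => rw [smul_add, map_add, map_add, hs, ht])

theorem assocHom_tmul (y : Y) (x : X) (n : N) :
    assocHom Y X N (BalTensor.tmul A y (BalTensor.tmul A x n)) =
      BalTensor.tmul A (BalTensor.tmul A y x) n := rfl

/-- The map `y ⊗ x ↦ (n ↦ y ⊗ (x ⊗ n))`. -/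
def assocInvAux : BalTensor A Y X →+ N →+ BalTensor A Y (BalTensor A X N) :=
  BalTensor.liftAdd
    (AddMonoidHom.mk' (fun y => AddMonoidHom.mk'
        (fun x => (BalTensor.tmulHom A Y (BalTensor A X N) y).comp (BalTensor.tmulHom A X N x))
        (fun x x' => by rw [map_add, AddMonoidHom.comp_add]))
      (fun y y' => by
        ext x n
        exact BalTensor.add_tmul y y' _))
    (fun y a x => by
      ext n
      change BalTensor.tmul A (op a • y) (BalTensor.tmul A x n) =
        BalTensor.tmul A y (BalTensor.tmul A (a • x) n)
      rw [BalTensor.smul_tmul, BalTensor.op_smul_tmul])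

theorem assocInvAux_tmul (y : Y) (x : X) (n : N) : assocInvAux Y X N (BalTensor.tmul A y x) n =
    BalTensor.tmul A y (BalTensor.tmul A x n) := rfl

/-- The inverse of the associativity isomorphism. -/
def assocInv : BalTensor A (BalTensor A Y X) N →ₗ[A] BalTensor A Y (BalTensor A X N) :=
  BalTensor.lift (assocInvAux Y X N)
    (fun b t n => by
      induction t using BalTensor.induction with
      | h0 => rw [smul_zero, map_zero, AddMonoidHom.zero_apply, smul_zero]
      | h1 y x =>
        rw [← BalTensor.smul_tmul, assocInvAux_tmul, assocInvAux_tmul, BalTensor.smul_tmul]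
      | h2 s t hs ht =>
        rw [smul_add, map_add, map_add, AddMonoidHom.add_apply, AddMonoidHom.add_apply, hs, ht,
          smul_add])
    (fun t a n => by
      induction t using BalTensor.induction with
      | h0 => rw [smul_zero, map_zero, AddMonoidHom.zero_apply, AddMonoidHom.zero_apply]
      | h1 y x =>
        rw [BalTensor.right_smul_tmul, assocInvAux_tmul, assocInvAux_tmul,
          BalTensor.op_smul_tmul]
      | h2 s t hs ht =>
        rw [smul_add, map_add, map_add, AddMonoidHom.add_apply, AddMonoidHom.add_apply, hs, ht])

theorem assocInv_tmul (y : Y) (x : X) (n : N) :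
    assocInv Y X N (BalTensor.tmul A (BalTensor.tmul A y x) n) =
      BalTensor.tmul A y (BalTensor.tmul A x n) := rfl

theorem assocInv_assocHom (t : BalTensor A Y (BalTensor A X N)) :
    assocInv Y X N (assocHom Y X N t) = t := by
  induction t using BalTensor.induction with
  | h0 => rw [map_zero, map_zero]
  | h1 y s =>
    induction s using BalTensor.induction with
    | h0 => rw [BalTensor.tmul_zero, map_zero, map_zero]
    | h1 x n => rw [assocHom_tmul, assocInv_tmul]
    | h2 s t hs ht => rw [BalTensor.tmul_add, map_add, map_add, hs, ht]
  | h2 s t hs ht => rw [map_add, map_add, hs, ht]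

theorem assocHom_assocInv (t : BalTensor A (BalTensor A Y X) N) :
    assocHom Y X N (assocInv Y X N t) = t := by
  induction t using BalTensor.induction with
  | h0 => rw [map_zero, map_zero]
  | h1 s n =>
    induction s using BalTensor.induction with
    | h0 => rw [BalTensor.zero_tmul, map_zero, map_zero]
    | h1 y x => rw [assocInv_tmul, assocHom_tmul]
    | h2 s t hs ht => rw [BalTensor.add_tmul, map_add, map_add, hs, ht]
  | h2 s t hs ht => rw [map_add, map_add, hs, ht]

variable {N} in
theorem assocHom_natural {N' : Type*} [AddCommGroup N'] [Module A N'] (f : N →ₗ[A] N')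
    (t : BalTensor A Y (BalTensor A X N)) :
    assocHom Y X N' (BalTensor.map (BimHom.id A Y) (BalTensor.map (BimHom.id A X) f) t) =
      BalTensor.map (BimHom.id A (BalTensor A Y X)) f (assocHom Y X N t) := by
  induction t using BalTensor.induction with
  | h0 => simp only [map_zero]
  | h1 y s =>
    induction s using BalTensor.induction with
    | h0 => rw [BalTensor.tmul_zero]; simp only [map_zero]
    | h1 x n => rfl
    | h2 s t hs ht => rw [BalTensor.tmul_add]; simp only [map_add, hs, ht]
  | h2 s t hs ht => simp only [map_add, hs, ht]

/-- Associativity of tensor products. -/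
def assocEquiv : BalTensor A Y (BalTensor A X N) ≃ₗ[A] BalTensor A (BalTensor A Y X) N :=
  { assocHom Y X N with
    invFun := assocInv Y X N
    left_inv := assocInv_assocHom Y X N
    right_inv := assocHom_assocInv Y X N }

end Assoc

/-- Composition of tensor functors is the tensor functor of the tensor product. -/
def tensorAssocIso {A : Type u} [Ring A] (Y X : Bimodule A) :
    tensorFunctor X ⋙ tensorFunctor Y ≅
      tensorFunctor (⟨BalTensor A Y.carrier X.carrier⟩ : Bimodule A) :=
  NatIso.ofComponents
    (fun N => (assocEquiv (A := A) Y.carrier X.carrier N).toModuleIso)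
    (fun f => by
      ext1
      exact LinearMap.ext (assocHom_natural Y.carrier X.carrier f.hom))

section Summands

variable (k : Type*) [Field k] {A : Type u} [Ring A] [Algebra k A]
variable {X Y X' Y' : Type*}
variable [AddCommGroup X] [Module A X] [Module Aᵐᵒᵖ X] [SMulCommClass A Aᵐᵒᵖ X]
variable [AddCommGroup Y] [Module A Y] [Module Aᵐᵒᵖ Y] [SMulCommClass A Aᵐᵒᵖ Y]
variable [AddCommGroup X'] [Module A X'] [Module Aᵐᵒᵖ X'] [SMulCommClass A Aᵐᵒᵖ X']
variable [AddCommGroup Y'] [Module A Y'] [Module Aᵐᵒᵖ Y'] [SMulCommClass A Aᵐᵒᵖ Y']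

/-- Maps which factor through a finite direct sum of copies of `A` and `A ⊗_k A`. -/
def Factors (φ : X → Y) : Prop :=
  ∃ (n : ℕ) (i : BimHom A X (Fin n → A × Outer k A A A))
    (p : BimHom A (Fin n → A × Outer k A A A) Y), ∀ x, p.toLin (i.toLin x) = φ x

theorem Factors.sandwich {φ : X → Y} (h : Factors (A := A) k φ) (f : BimHom A X' X)
    (g : BimHom A Y Y') : Factors (A := A) k (fun x => g.toLin (φ (f.toLin x))) := by
  obtain ⟨n, i, p, h⟩ := h
  exact ⟨n, i.comp f, g.comp p, fun x => congrArg g.toLin (h (f.toLin x))⟩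

theorem Factors.zero : Factors (A := A) k (fun _ : X => (0 : Y)) :=
  ⟨0, ⟨0, fun _ _ => by simp⟩, ⟨0, fun _ _ => by simp⟩, fun _ => rfl⟩

theorem Factors.add {φ ψ : X → Y} (h : Factors (A := A) k φ) (h' : Factors (A := A) k ψ) :
    Factors (A := A) k (fun x => φ x + ψ x) := by
  obtain ⟨n, i, p, h⟩ := h
  obtain ⟨m, j, q, h'⟩ := h'
  refine ⟨n + m,
    ⟨{ toFun := fun x => Fin.append (i.toLin x) (j.toLin x)
       map_add' := fun x y => ?_
       map_smul' := fun a x => ?_ }, fun a x => ?_⟩,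
    ⟨p.toLin ∘ₗ LinearMap.funLeft A _ (Fin.castAdd m) +
      q.toLin ∘ₗ LinearMap.funLeft A _ (Fin.natAdd n), fun a s => ?_⟩, fun x => ?_⟩
  · funext l; refine Fin.addCases (fun l => ?_) (fun l => ?_) l <;> simp
  · funext l; refine Fin.addCases (fun l => ?_) (fun l => ?_) l <;> simp
  · funext l
    refine Fin.addCases (fun l => ?_) (fun l => ?_) l <;> simp [i.map_right, j.map_right]
  · have h1 : LinearMap.funLeft A _ (Fin.castAdd m) (op a • s) =
      op a • LinearMap.funLeft A _ (Fin.castAdd m) s := rfl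
    have h2 : LinearMap.funLeft A _ (Fin.natAdd n) (op a • s) =
      op a • LinearMap.funLeft A _ (Fin.natAdd n) s := rfl
    simp only [LinearMap.add_apply, LinearMap.comp_apply, h1, h2, p.map_right, q.map_right,
      smul_add]
  · have e1 : (fun l => Fin.append (i.toLin x) (j.toLin x) (Fin.castAdd m l)) = i.toLin x := by
      funext l; simp
    have e2 : (fun l => Fin.append (i.toLin x) (j.toLin x) (Fin.natAdd n l)) = j.toLin x := by
      funext l; simp
    change p.toLin (fun l => Fin.append (i.toLin x) (j.toLin x) (Fin.castAdd m l)) +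
      q.toLin (fun l => Fin.append (i.toLin x) (j.toLin x) (Fin.natAdd n l)) = φ x + ψ x
    rw [e1, e2, h, h']

theorem Factors.sum {ι : Type*} (s : Finset ι) (φ : ι → X → Y)
    (h : ∀ a ∈ s, Factors (A := A) k (φ a)) : Factors (A := A) k (fun x => ∑ a ∈ s, φ a x) := by
  classical
  induction s using Finset.induction_on with
  | empty => simpa using Factors.zero k
  | insert a s ha ih =>
    simp only [Finset.sum_insert ha]
    exact (h a (Finset.mem_insert_self a s)).add k
      (ih fun b hb => h b (Finset.mem_insert_of_mem hb))

theorem Factors.congr {φ ψ : X → Y} (h : Factors (A := A) k φ) (e : ∀ x, φ x = ψ x) :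
    Factors (A := A) k ψ := by
  obtain ⟨n, i, p, h⟩ := h
  exact ⟨n, i, p, fun x => (h x).trans (e x)⟩

theorem inAdd_iff : InAdd k A X ↔ Factors (A := A) k (fun x : X => x) := Iff.rfl

theorem inAdd_regular : InAdd k A A :=
  ⟨1, ⟨LinearMap.pi fun _ => LinearMap.inl A A _, fun a x => by ext <;> simp⟩,
    ⟨LinearMap.fst A A _ ∘ₗ LinearMap.proj 0, fun a x => by simp⟩, fun x => by simp⟩

theorem inAdd_free : InAdd k A (Outer k A A A) :=
  ⟨1, ⟨LinearMap.pi fun _ => LinearMap.inr A A _, fun a x => by ext <;> simp⟩,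
    ⟨LinearMap.snd A A _ ∘ₗ LinearMap.proj 0, fun a x => by simp⟩, fun x => by simp⟩

/-- The inclusions and projections of the standard summands. -/
def inA (n : ℕ) (l : Fin n) : BimHom A A (Fin n → A × Outer k A A A) :=
  ⟨LinearMap.single A _ l ∘ₗ LinearMap.inl A A _, fun a x => by
    funext m
    by_cases h : m = l
    · subst h; ext <;> simp
    · ext <;> simp [h]⟩

/-- The inclusion of a summand `A ⊗_k A`. -/
def inF (n : ℕ) (l : Fin n) : BimHom A (Outer k A A A) (Fin n → A × Outer k A A A) :=
  ⟨LinearMap.single A _ l ∘ₗ LinearMap.inr A A _, fun a x => by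
    funext m
    by_cases h : m = l
    · subst h; ext <;> simp
    · ext <;> simp [h]⟩

/-- The projection to a summand `A`. -/
def prA (n : ℕ) (l : Fin n) : BimHom A (Fin n → A × Outer k A A A) A :=
  ⟨LinearMap.fst A A _ ∘ₗ LinearMap.proj l, fun a x => by simp⟩

/-- The projection to a summand `A ⊗_k A`. -/
def prF (n : ℕ) (l : Fin n) : BimHom A (Fin n → A × Outer k A A A) (Outer k A A A) :=
  ⟨LinearMap.snd A A _ ∘ₗ LinearMap.proj l, fun a x => by simp⟩

theorem sum_in_pr (n : ℕ) (s : Fin n → A × Outer k A A A) :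
    ∑ l, ((inA k n l).toLin ((prA k n l).toLin s) + (inF k n l).toLin ((prF k n l).toLin s)) =
      s := by
  have : ∀ l, (inA k n l).toLin ((prA k n l).toLin s) + (inF k n l).toLin ((prF k n l).toLin s)
      = Pi.single l (s l) := by
    intro l
    simp only [inA, prA, inF, prF, LinearMap.comp_apply, ← map_add]
    simp
  simp only [this]
  exact Finset.univ_sum_single s

/-- Decomposition of the identity of an object of the additive closure. -/
theorem InAdd.decomp (h : InAdd k A X) : ∃ (n : ℕ) (f : Fin n → BimHom A X A)
    (g : Fin n → BimHom A A X) (f' : Fin n → BimHom A X (Outer k A A A))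
    (g' : Fin n → BimHom A (Outer k A A A) X),
    ∀ x, ∑ l, ((g l).toLin ((f l).toLin x) + (g' l).toLin ((f' l).toLin x)) = x := by
  obtain ⟨n, i, p, h⟩ := h
  refine ⟨n, fun l => (prA k n l).comp i, fun l => p.comp (inA k n l),
    fun l => (prF k n l).comp i, fun l => p.comp (inF k n l), fun x => ?_⟩
  conv_rhs => rw [← h x, ← sum_in_pr k n (i.toLin x)]
  simp [BimHom.comp]

theorem InAdd.tensor_left (h : InAdd k A Y) (h1 : InAdd k A (BalTensor A A X))
    (h2 : InAdd k A (BalTensor A (Outer k A A A) X)) : InAdd k A (BalTensor A Y X) := by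
  obtain ⟨n, f, g, f', g', e⟩ := h.decomp
  have := Factors.sum k Finset.univ (fun l (t : BalTensor A Y X) =>
      ((g l).tensor (BimHom.id A X)).toLin (((f l).tensor (BimHom.id A X)).toLin t) +
      ((g' l).tensor (BimHom.id A X)).toLin (((f' l).tensor (BimHom.id A X)).toLin t))
    (fun l _ => Factors.add k (Factors.sandwich k h1 _ _) (Factors.sandwich k h2 _ _))
  refine this.congr k fun t => ?_
  induction t using BalTensor.induction with
  | h0 => simp
  | h1 y x =>
    conv_rhs => rw [← e y]
    change ∑ l, (BalTensor.tmul A ((g l).toLin ((f l).toLin y)) x +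
      BalTensor.tmul A ((g' l).toLin ((f' l).toLin y)) x) = _
    simp only [← BalTensor.add_tmul]
    exact (map_sum ((BalTensor.tmulHom A Y X).flip x) _ _).symm
  | h2 s t hs ht =>
    conv_rhs => rw [← hs, ← ht, ← Finset.sum_add_distrib]
    refine Finset.sum_congr rfl fun l _ => ?_
    simp only [map_add]
    abel

theorem InAdd.tensor_right (h : InAdd k A X) (h1 : InAdd k A (BalTensor A Y A))
    (h2 : InAdd k A (BalTensor A Y (Outer k A A A))) : InAdd k A (BalTensor A Y X) := by
  obtain ⟨n, f, g, f', g', e⟩ := h.decomp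
  have := Factors.sum k Finset.univ (fun l (t : BalTensor A Y X) =>
      ((BimHom.id A Y).tensor (g l)).toLin (((BimHom.id A Y).tensor (f l)).toLin t) +
      ((BimHom.id A Y).tensor (g' l)).toLin (((BimHom.id A Y).tensor (f' l)).toLin t))
    (fun l _ => Factors.add k (Factors.sandwich k h1 _ _) (Factors.sandwich k h2 _ _))
  refine this.congr k fun t => ?_
  induction t using BalTensor.induction with
  | h0 => simp
  | h1 y x =>
    conv_rhs => rw [← e x]
    change ∑ l, (BalTensor.tmul A y ((g l).toLin ((f l).toLin x)) +
      BalTensor.tmul A y ((g' l).toLin ((f' l).toLin x))) = _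
    simp only [← BalTensor.tmul_add]
    exact (map_sum (BalTensor.tmulHom A Y X y) _ _).symm
  | h2 s t hs ht =>
    conv_rhs => rw [← hs, ← ht, ← Finset.sum_add_distrib]
    refine Finset.sum_congr rfl fun l _ => ?_
    simp only [map_add]
    abel

theorem InAdd.of_retract (h : InAdd k A Y) (f : BimHom A X Y) (g : BimHom A Y X)
    (e : ∀ x, g.toLin (f.toLin x) = x) : InAdd k A X :=
  (Factors.sandwich k h f g).congr k e

theorem InAdd.unit_tensor (h : InAdd k A X) : InAdd k A (BalTensor A A X) :=
  h.of_retract k (.ofTensor (unitHom X) fun a b x => smul_comm b (op a) x)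
    ⟨unitInv X, fun _ _ => rfl⟩ (unitInv_unitHom X)

/-- The right unit isomorphism `Y ⊗_A A → Y`. -/
def runitHom (Y : Type*) [AddCommGroup Y] [Module A Y] [Module Aᵐᵒᵖ Y] [SMulCommClass A Aᵐᵒᵖ Y] :
    BalTensor A Y A →ₗ[A] Y :=
  BalTensor.lift
    (AddMonoidHom.mk' (fun y => AddMonoidHom.mk' (fun a : A => op a • y)
        (fun a b => by rw [MulOpposite.op_add, add_smul]))
      (fun y y' => by ext a; simp))
    (fun b y a => (smul_comm b (op a) y).symm)
    (fun y a b => by simp [mul_smul])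

theorem runitHom_tmul (y : Y) (a : A) : runitHom Y (BalTensor.tmul A y a) = op a • y := rfl

theorem InAdd.tensor_unit (h : InAdd k A Y) : InAdd k A (BalTensor A Y A) := by
  refine h.of_retract k
    (.ofTensor (runitHom Y) (fun a y b => by simp [runitHom_tmul, mul_smul]))
    ⟨{ toFun := fun y => BalTensor.tmul A y (1 : A)
       map_add' := fun y y' => BalTensor.add_tmul y y' 1
       map_smul' := fun a y => BalTensor.smul_tmul a y 1 }, fun a y => ?_⟩ fun t => ?_
  · change BalTensor.tmul A (op a • y) (1 : A) = op a • BalTensor.tmul A y (1 : A)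
    rw [BalTensor.op_smul_tmul, BalTensor.right_smul_tmul]; simp
  · change BalTensor.tmul A (runitHom Y t) (1 : A) = t
    induction t using BalTensor.induction with
    | h0 => rw [map_zero, BalTensor.zero_tmul]
    | h1 y a =>
      rw [runitHom_tmul, BalTensor.op_smul_tmul]; simp
    | h2 s t hs ht => rw [map_add, BalTensor.add_tmul, hs, ht]

/-- The map `(x ⊗ y, z ⊗ w) ↦ φ (y z) x ⊗ w`. -/
def contractLin (φ : A →ₗ[k] k) : (A ⊗[k] A) →ₗ[k] (A ⊗[k] A) →ₗ[k] (A ⊗[k] A) :=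
  TensorProduct.lift (LinearMap.mk₂ k (fun x y =>
      TensorProduct.lift ((φ ∘ₗ LinearMap.mulLeft k y).smulRight (TensorProduct.mk k A A x)))
    (fun x x' y => by ext z w; simp)
    (fun c x y => by
      ext z w; simp [TensorProduct.smul_tmul', smul_smul, mul_comm])
    (fun x y y' => by ext z w; simp [add_mul, add_smul])
    (fun c x y => by ext z w; simp [mul_smul]))

/-- The map `(x ⊗ y, z ⊗ w) ↦ φ (y z) x ⊗ w`. -/
def contract (φ : A →ₗ[k] k) : Outer k A A A →+ Outer k A A A →+ Outer k A A A :=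
  AddMonoidHom.mk' (fun s => (contractLin k φ s).toAddMonoidHom)
    (fun s t => AddMonoidHom.ext fun u =>
      congrArg (fun f : (A ⊗[k] A) →ₗ[k] (A ⊗[k] A) => f u) (map_add (contractLin k φ) s t))

theorem contract_tmul (φ : A →ₗ[k] k) (x y z w : A) :
    contract k φ (Outer.tmul k A x y) (Outer.tmul k A z w) =
      Outer.tmul k A (φ (y * z) • x) w := by
  change contractLin k φ (x ⊗ₜ y) (z ⊗ₜ w) = (φ (y * z) • x) ⊗ₜ w
  simp [contractLin, TensorProduct.smul_tmul']

/-- The map `(x ⊗ y) ⊗ (z ⊗ w) ↦ φ (y z) x ⊗ w`. -/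
def contractHom (φ : A →ₗ[k] k) :
    BimHom A (BalTensor A (Outer k A A A) (Outer k A A A)) (Outer k A A A) :=
  .ofTensor (BalTensor.lift (contract k φ)
    (fun b s t => by
      induction s using Outer.induction with
      | h0 => simp
      | h1 x y =>
        induction t using Outer.induction with
        | h0 => simp
        | h1 z w => simp [contract_tmul]
        | h2 s t hs ht => rw [map_add, map_add, smul_add, hs, ht]
      | h2 s s' hs hs' =>
        rw [smul_add, map_add, map_add, AddMonoidHom.add_apply, AddMonoidHom.add_apply, smul_add,
          hs, hs'])
    (fun s a t => by
      induction s using Outer.induction with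
      | h0 => simp
      | h1 x y =>
        induction t using Outer.induction with
        | h0 => simp
        | h1 z w => simp [contract_tmul, mul_assoc]
        | h2 s t hs ht => rw [smul_add, map_add, map_add, hs, ht]
      | h2 s s' hs hs' =>
        rw [smul_add, map_add, map_add, AddMonoidHom.add_apply, AddMonoidHom.add_apply, hs, hs']))
    (fun a s t => by
      rw [BalTensor.lift_tmul, BalTensor.lift_tmul]
      induction s using Outer.induction with
      | h0 => simp
      | h1 x y =>
        induction t using Outer.induction with
        | h0 => simp
        | h1 z w => simp [contract_tmul]
        | h2 s t hs ht => rw [smul_add, map_add, map_add, smul_add, hs, ht]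
      | h2 s s' hs hs' =>
        rw [map_add, AddMonoidHom.add_apply, AddMonoidHom.add_apply, smul_add, hs, hs'])

theorem contractHom_tmul (φ : A →ₗ[k] k) (x y z w : A) :
    (contractHom k φ).toLin (BalTensor.tmul A (Outer.tmul k A x y) (Outer.tmul k A z w)) =
      Outer.tmul k A (φ (y * z) • x) w := contract_tmul k φ x y z w

/-- The map `x ⊗ w ↦ (x ⊗ b) ⊗ (1 ⊗ w)`. -/
def expandAdd (b : A) : Outer k A A A →+ BalTensor A (Outer k A A A) (Outer k A A A) :=
  TensorProduct.liftAddHom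
    (AddMonoidHom.mk' (fun x : A => AddMonoidHom.mk' (fun w : A =>
        BalTensor.tmul A (Outer.tmul k A x b) (Outer.tmul k A 1 w))
        (fun w w' => by rw [Outer.tmul_add, BalTensor.tmul_add]))
      (fun x x' => AddMonoidHom.ext fun w => by
        rw [AddMonoidHom.mk'_apply, Outer.add_tmul, BalTensor.add_tmul]; rfl))
    (fun r x w => by
      change BalTensor.tmul A (Outer.tmul k A (r • x) b) (Outer.tmul k A 1 w) =
        BalTensor.tmul A (Outer.tmul k A x b) (Outer.tmul k A 1 (r • w))
      have h1 : Outer.tmul k A (r • x) b = op (algebraMap k A r) • Outer.tmul k A x b := by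
        rw [Outer.op_smul_tmul, op_smul_eq_mul, ← Algebra.commutes, ← Algebra.smul_def]
        exact Outer.smul_tmul_comm k A r x b
      have h2 : Outer.tmul k A (1 : A) (r • w) = algebraMap k A r • Outer.tmul k A (1 : A) w := by
        rw [Outer.smul_tmul, smul_eq_mul, mul_one, Algebra.algebraMap_eq_smul_one]
        exact (Outer.smul_tmul_comm k A r (1 : A) w).symm
      rw [h1, h2, BalTensor.op_smul_tmul])

theorem expandAdd_tmul (b x w : A) : expandAdd k b (Outer.tmul k A x w) =
    BalTensor.tmul A (Outer.tmul k A x b) (Outer.tmul k A 1 w) := rfl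

/-- The map `x ⊗ w ↦ (x ⊗ b) ⊗ (1 ⊗ w)` as a homomorphism of bimodules. -/
def expand (b : A) : BimHom A (Outer k A A A) (BalTensor A (Outer k A A A) (Outer k A A A)) where
  toLin :=
    { expandAdd k b with
      map_smul' := fun a t => by
        change expandAdd k b (a • t) = a • expandAdd k b t
        induction t using Outer.induction with
        | h0 => simp
        | h1 x w =>
          rw [Outer.smul_tmul, expandAdd_tmul, expandAdd_tmul, ← BalTensor.smul_tmul,
            Outer.smul_tmul]
        | h2 s t hs ht => rw [smul_add, map_add, map_add, smul_add, hs, ht] }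
  map_right a t := by
    change expandAdd k b (op a • t) = op a • expandAdd k b t
    induction t using Outer.induction with
    | h0 => simp
    | h1 x w =>
      rw [Outer.op_smul_tmul, expandAdd_tmul, expandAdd_tmul, BalTensor.right_smul_tmul,
        Outer.op_smul_tmul]
    | h2 s t hs ht => rw [smul_add, map_add, map_add, smul_add, hs, ht]

theorem inAdd_free_free [Module.Finite k A] :
    InAdd k A (BalTensor A (Outer k A A A) (Outer k A A A)) := by
  let b := Module.finBasis k A
  have := Factors.sum k Finset.univ
    (fun l (t : BalTensor A (Outer k A A A) (Outer k A A A)) =>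
      (expand k (b l)).toLin ((contractHom k (b.coord l)).toLin t))
    (fun l _ => Factors.sandwich k (inAdd_free k) (contractHom k (b.coord l)) (expand k (b l)))
  refine this.congr k fun t => ?_
  induction t using BalTensor.induction with
  | h0 => simp
  | h2 s t hs ht =>
    conv_rhs => rw [← hs, ← ht, ← Finset.sum_add_distrib]
    simp only [map_add]
  | h1 s u =>
    induction s using Outer.induction with
    | h0 => simp [BalTensor.zero_tmul]
    | h2 s t hs ht =>
      rw [BalTensor.add_tmul]
      conv_rhs => rw [← hs, ← ht, ← Finset.sum_add_distrib]
      simp only [map_add]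
    | h1 x y =>
      induction u using Outer.induction with
      | h0 => simp [BalTensor.tmul_zero]
      | h2 s t hs ht =>
        rw [BalTensor.tmul_add]
        conv_rhs => rw [← hs, ← ht, ← Finset.sum_add_distrib]
        simp only [map_add]
      | h1 z w =>
        have h1 : ∀ l, (expand k (b l)).toLin ((contractHom k (b.coord l)).toLin
            (BalTensor.tmul A (Outer.tmul k A x y) (Outer.tmul k A z w))) =
            (BalTensor.tmulHom A (Outer k A A A) (Outer k A A A)).flip (Outer.tmul k A 1 w)
              (Outer.tmul k A x (b.repr (y * z) l • b l)) := fun l => by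
          rw [contractHom_tmul, ← Outer.smul_tmul_comm]
          rfl
        have h2 : ∑ l, Outer.tmul k A x (b.repr (y * z) l • b l) = Outer.tmul k A x (y * z) := by
          conv_rhs => rw [← b.sum_repr (y * z)]
          exact (map_sum (AddMonoidHom.mk' (Outer.tmul k A x) (Outer.tmul_add k A x)) _ _).symm
        rw [Finset.sum_congr rfl fun l _ => h1 l, ← map_sum, h2]
        change BalTensor.tmul A (Outer.tmul k A x (y * z)) (Outer.tmul k A 1 w) = _
        have h3 : Outer.tmul k A x (y * z) = op z • Outer.tmul k A x y := rfl
        rw [h3, BalTensor.op_smul_tmul, Outer.smul_tmul, smul_eq_mul, mul_one]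

/-- The additive closure of `A` and `A ⊗_k A` is closed under tensor products over `A`. -/
theorem InAdd.tensor [Module.Finite k A] (hY : InAdd k A Y) (hX : InAdd k A X) :
    InAdd k A (BalTensor A Y X) :=
  hY.tensor_left k (hX.unit_tensor k)
    (hX.tensor_right k ((inAdd_free k).tensor_unit k) (inAdd_free_free k))


end Summands

end Closure

section TwoCategory

variable (k : Type*) [Field k] {A : Type u} [Ring A] [Algebra k A]
variable {𝒞 : Type u₁} [Category.{v₁} 𝒞] (E : 𝒞 ≌ FGModuleCat.{u} A)

/-- The endofunctor `G` of a category equivalent to `A`-mod (finitely generated left modules) is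
given by tensoring with the bimodule `X`. -/
def IsTensoring (G : 𝒞 ⥤ 𝒞) (X : Bimodule A) : Prop :=
  Nonempty (G ⋙ E.functor ⋙ (ModuleCat.isFG.{u} A).ι ≅
    (E.functor ⋙ (ModuleCat.isFG.{u} A).ι) ⋙ tensorFunctor X)

/-- The endofunctors isomorphic to tensoring with a bimodule from the additive closure of
`A` and `A ⊗_k A`. -/
def oneMorphisms : ObjectProperty (𝒞 ⥤ 𝒞) := fun G =>
  ∃ X : Bimodule A, InAdd k A X.carrier ∧ IsTensoring E G X

instance [Module.Finite k A] : (oneMorphisms k E).IsMonoidal where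
  prop_unit := ⟨⟨A⟩, inAdd_regular k,
    ⟨Functor.leftUnitor _ ≪≫ (Functor.rightUnitor _).symm ≪≫
      Functor.isoWhiskerLeft _ tensorUnitIso.symm⟩⟩
  prop_tensor := by
    rintro G H ⟨X, hX, ⟨e⟩⟩ ⟨Y, hY, ⟨f⟩⟩
    exact ⟨⟨BalTensor A Y.carrier X.carrier⟩, hY.tensor k hX,
      ⟨(Functor.associator _ _ _ : (G ⋙ H) ⋙ _ ≅ G ⋙ H ⋙ _) ≪≫
        Functor.isoWhiskerLeft G f ≪≫ (Functor.associator _ _ _).symm ≪≫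
        Functor.isoWhiskerRight e (tensorFunctor Y) ≪≫ Functor.associator _ _ _ ≪≫
        Functor.isoWhiskerLeft _ (tensorAssocIso Y X)⟩⟩

/-- The 2-category of projective functors. It has one object, so it is given by the monoidal
category of its 1-morphisms; the 2-morphisms are all natural transformations, and `G ⊗ H` is the
composition `G ⋙ H` (first `G`, then `H`). -/
abbrev ProjTwoCat : Type _ := (oneMorphisms k E).FullSubcategory

end TwoCategory

section QuiverAlgebra

/-- The algebra of the quiver `1 → 2 → 3`, with arrows `α : 1 → 2` and `β : 2 → 3`, modulo
`βα = 0`: elements are written in the basis `e₁, e₂, e₃, α, β`. -/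
@[ext]
structure QuiverAlg (k : Type u) where
  c₁ : k
  c₂ : k
  c₃ : k
  cα : k
  cβ : k

namespace QuiverAlg

variable (k : Type u) [Field k]

/-- Coordinates in the basis `e₁, e₂, e₃, α, β`. -/
def coords : QuiverAlg k ≃ k × k × k × k × k where
  toFun x := (x.c₁, x.c₂, x.c₃, x.cα, x.cβ)
  invFun y := ⟨y.1, y.2.1, y.2.2.1, y.2.2.2.1, y.2.2.2.2⟩

instance : AddCommGroup (QuiverAlg k) := (coords k).addCommGroup

instance : Module k (QuiverAlg k) := (coords k).module k

/-- The multiplication with `eᵢ eᵢ = eᵢ`, `e₂ α = α = α e₁`, `e₃ β = β = β e₂`, and all other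
products of basis elements equal to zero. -/
instance : Mul (QuiverAlg k) where
  mul x y := ⟨x.c₁ * y.c₁, x.c₂ * y.c₂, x.c₃ * y.c₃,
    x.c₂ * y.cα + x.cα * y.c₁, x.c₃ * y.cβ + x.cβ * y.c₂⟩

instance : One (QuiverAlg k) := ⟨⟨1, 1, 1, 0, 0⟩⟩

variable {k}

@[simp] theorem zero_c₁ : (0 : QuiverAlg k).c₁ = 0 := rfl
@[simp] theorem zero_c₂ : (0 : QuiverAlg k).c₂ = 0 := rfl
@[simp] theorem zero_c₃ : (0 : QuiverAlg k).c₃ = 0 := rfl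
@[simp] theorem zero_cα : (0 : QuiverAlg k).cα = 0 := rfl
@[simp] theorem zero_cβ : (0 : QuiverAlg k).cβ = 0 := rfl
@[simp] theorem one_c₁ : (1 : QuiverAlg k).c₁ = 1 := rfl
@[simp] theorem one_c₂ : (1 : QuiverAlg k).c₂ = 1 := rfl
@[simp] theorem one_c₃ : (1 : QuiverAlg k).c₃ = 1 := rfl
@[simp] theorem one_cα : (1 : QuiverAlg k).cα = 0 := rfl
@[simp] theorem one_cβ : (1 : QuiverAlg k).cβ = 0 := rfl

section

variable (x y : QuiverAlg k) (r : k)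

@[simp] theorem add_c₁ : (x + y).c₁ = x.c₁ + y.c₁ := rfl
@[simp] theorem add_c₂ : (x + y).c₂ = x.c₂ + y.c₂ := rfl
@[simp] theorem add_c₃ : (x + y).c₃ = x.c₃ + y.c₃ := rfl
@[simp] theorem add_cα : (x + y).cα = x.cα + y.cα := rfl
@[simp] theorem add_cβ : (x + y).cβ = x.cβ + y.cβ := rfl
@[simp] theorem mul_c₁ : (x * y).c₁ = x.c₁ * y.c₁ := rfl
@[simp] theorem mul_c₂ : (x * y).c₂ = x.c₂ * y.c₂ := rfl
@[simp] theorem mul_c₃ : (x * y).c₃ = x.c₃ * y.c₃ := rfl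
@[simp] theorem mul_cα : (x * y).cα = x.c₂ * y.cα + x.cα * y.c₁ := rfl
@[simp] theorem mul_cβ : (x * y).cβ = x.c₃ * y.cβ + x.cβ * y.c₂ := rfl
@[simp] theorem smul_c₁ : (r • x).c₁ = r * x.c₁ := rfl
@[simp] theorem smul_c₂ : (r • x).c₂ = r * x.c₂ := rfl
@[simp] theorem smul_c₃ : (r • x).c₃ = r * x.c₃ := rfl
@[simp] theorem smul_cα : (r • x).cα = r * x.cα := rfl
@[simp] theorem smul_cβ : (r • x).cβ = r * x.cβ := rfl

end

instance : Ring (QuiverAlg k) :=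
  { (inferInstance : AddCommGroup (QuiverAlg k)), (inferInstance : Mul (QuiverAlg k)),
    (inferInstance : One (QuiverAlg k)) with
    left_distrib := fun x y z => by ext <;> simp <;> ring
    right_distrib := fun x y z => by ext <;> simp <;> ring
    zero_mul := fun x => by ext <;> simp
    mul_zero := fun x => by ext <;> simp
    mul_assoc := fun x y z => by ext <;> simp <;> ring
    one_mul := fun x => by ext <;> simp
    mul_one := fun x => by ext <;> simp }

instance : Algebra k (QuiverAlg k) :=
  Algebra.ofModule (fun r x y => by ext <;> simp <;> ring) (fun r x y => by ext <;> simp <;> ring)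

instance : Module.Finite k (QuiverAlg k) :=
  Module.Finite.equiv (Equiv.linearEquiv k (coords k)).symm

variable (k)

/-- The primitive idempotents `e₁, e₂, e₃` (indexed by `0, 1, 2`). -/
def e : Fin 3 → QuiverAlg k := ![⟨1, 0, 0, 0, 0⟩, ⟨0, 1, 0, 0, 0⟩, ⟨0, 0, 1, 0, 0⟩]

/-- The bimodule `A eᵢ ⊗_k eⱼ A`. -/
def bimodule (i j : Fin 3) : Bimodule (QuiverAlg k) :=
  outer k (QuiverAlg k) (Submodule.span (QuiverAlg k) {e k i})
    (Submodule.span (QuiverAlg k)ᵐᵒᵖ {e k j})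

end QuiverAlg

end QuiverAlgebra

section TwoRepresentations

variable (k : Type*) [Field k]

/-- A complete and irredundant list of representatives of the isomorphism classes of
indecomposable objects. -/
structure IsIndecList {M : Type w} [Category.{v} M] [Preadditive M] [HasFiniteBiproducts M]
    {n : ℕ} (X : Fin n → M) : Prop where
  indecomposable : ∀ i, Indecomposable (X i)
  irredundant : ∀ i j, Nonempty (X i ≅ X j) → i = j
  complete : ∀ Y : M, Indecomposable Y → ∃ i, Nonempty (Y ≅ X i)

/-- Finitary `k`-linear categories: additive, idempotent split, Krull-Schmidt, with finitely many
isomorphism classes of indecomposable objects and finite dimensional morphism spaces. -/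
structure IsFinitary (M : Type w) [Category.{v} M] [Preadditive M] [Linear k M]
    [HasFiniteBiproducts M] : Prop where
  idempotentComplete : IsIdempotentComplete M
  finite_hom : ∀ X Y : M, Module.Finite k (X ⟶ Y)
  krullSchmidt : ∀ X : M, ∃ (n : ℕ) (Z : Fin n → M),
    (∀ a, IsLocalRing (End (Z a))) ∧ Nonempty (X ≅ ⨁ Z)
  finite_indecomposable : ∃ (n : ℕ) (X : Fin n → M), IsIndecList X

/-- A 2-representation of a `k`-linear 2-category with one object (given as a monoidal category
`𝒟`) on a `k`-linear category `M`: a `k`-linear action of `𝒟` on `M` by `k`-linear functors.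
The action respects identities and compositions up to coherent isomorphism; strict actions are the
case where these isomorphisms are identities. -/
structure TwoRep (𝒟 : Type*) [Category 𝒟] [Preadditive 𝒟] [Linear k 𝒟] [MonoidalCategory 𝒟]
    (M : Type w) [Category.{v} M] [Preadditive M] [Linear k M] where
  act : 𝒟 ⥤ (M ⥤ M)
  [monoidal : act.Monoidal]
  [additive : act.Additive]
  [linear : act.Linear k]
  obj_additive : ∀ G : 𝒟, (act.obj G).Additive
  obj_linear : ∀ G : 𝒟, (act.obj G).Linear k

attribute [instance] TwoRep.monoidal TwoRep.additive TwoRep.linear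

namespace TwoRep

variable {k}
variable {𝒟 : Type*} [Category 𝒟] [Preadditive 𝒟] [Linear k 𝒟] [MonoidalCategory 𝒟]
variable {M : Type w} [Category.{v} M] [Preadditive M] [Linear k M] [HasFiniteBiproducts M]
variable (ρ : TwoRep k 𝒟 M)

/-- Every indecomposable object is a direct summand of the image of any other one under some
1-morphism. -/
def IsTransitive : Prop :=
  ∀ X Y : M, Indecomposable X → Indecomposable Y →
    ∃ (G : 𝒟) (Z : M), Nonempty ((ρ.act.obj G).obj X ≅ Y ⊞ Z)

/-- Ideals of the category `M` which are invariant under the action. -/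
structure InvariantIdeal where
  hom : ∀ X Y : M, Submodule k (X ⟶ Y)
  comp_left : ∀ {X Y Z : M} (f : X ⟶ Y) (g : Y ⟶ Z), g ∈ hom Y Z → f ≫ g ∈ hom X Z
  comp_right : ∀ {X Y Z : M} (f : X ⟶ Y) (g : Y ⟶ Z), f ∈ hom X Y → f ≫ g ∈ hom X Z
  map_mem : ∀ (G : 𝒟) {X Y : M} (f : X ⟶ Y), f ∈ hom X Y →
    (ρ.act.obj G).map f ∈ hom ((ρ.act.obj G).obj X) ((ρ.act.obj G).obj Y)

/-- A simple transitive 2-representation: transitive, without non-zero proper invariant ideals. -/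
def IsSimpleTransitive : Prop :=
  ρ.IsTransitive ∧ ∀ I : ρ.InvariantIdeal, (∀ X Y, I.hom X Y = ⊥) ∨ (∀ X Y, I.hom X Y = ⊤)

/-- Faithful: non-zero 2-morphisms act by non-zero natural transformations. -/
def IsFaithful : Prop := ρ.act.Faithful

/-- `N` is the matrix `[G]` with respect to the list `X` of indecomposable objects: the object
`X i` occurs `N i j` times in the decomposition of `G (X j)` into indecomposables. -/
def HasMatrix {n : ℕ} (X : Fin n → M) (G : 𝒟) (N : Matrix (Fin n) (Fin n) ℕ) : Prop :=
  ∀ j, Nonempty ((ρ.act.obj G).obj (X j) ≅ ⨁ fun p : (Σ i, Fin (N i j)) => X p.1)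

end TwoRep

end TwoRepresentations

/-- The matrix `N₁₃`. -/
def N₁₃ : Matrix (Fin 3) (Fin 3) ℕ :=
  !![2, 2, 1; 2, 2, 1; 2, 2, 1]

/-- The nine matrices, as a `3 × 3` array. -/
def cellMatrix : Fin 3 → Fin 3 → Matrix (Fin 3) (Fin 3) ℕ :=
  ![![!![1, 0, 0; 0, 0, 0; 0, 0, 0], !![1, 1, 0; 0, 0, 0; 0, 0, 0], !![0, 1, 1; 0, 0, 0; 0, 0, 0]],
    ![!![0, 0, 0; 1, 0, 0; 0, 0, 0], !![0, 0, 0; 1, 1, 0; 0, 0, 0], !![0, 0, 0; 0, 1, 1; 0, 0, 0]],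
    ![!![0, 0, 0; 0, 0, 0; 1, 0, 0], !![0, 0, 0; 0, 0, 0; 1, 1, 0], !![0, 0, 0; 0, 0, 0; 0, 1, 1]]]

end ProjFun

end

open ProjFun

/-! Write `c j s` for the dimension of `e_j A e_s`, with indices running over 0, 1, 2 as in the
code. Contracting the middle factor of `(A e_i ⊗ e_j A) ⊗_A (A e_s ⊗ e_l A)` shows that `F_ij ∘
F_sl` is a sum of `c j s` copies of `F_il`, and for this algebra each `c j s` is 0 or 1. The
multiplication `A e_i ⊗ e_i A → A` gives a 2-morphism from `F_ii` to the identity which is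
invertible on every object `F_il Z`, because `e_i A e_i` is one-dimensional. These facts, together
with the decomposition of any 1-morphism through copies of the identity and of the `F_ij`, are
collected in `IsCellSystem`; the rest uses nothing else about `A`.

By faithfulness `F_00` is not zero, so some `F_00 Z` has a summand `Y` with local endomorphism ring,
and the counit gives `F_00 Y ≅ Y` (`IsCellSystem.exists_fixed`). Put `W_i = F_i0 Y`. It is
indecomposable, since `F_0i` sends it to `Y` and kills none of its non-zero summands
(`IsCellSystem.indecomposable`). By transitivity every indecomposable object is a summand of some `G
Y`, hence of `Y` or of some `F_ij Y ≅ F_ij F_00 Y`, and so it is one of the `W_i`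
(`IsCellSystem.complete`). The composition rule gives `F_ij W_s ≅ W_i^(c j s)`, so the only non-zero
row of `[F_ij]` is row `i`, which is row `j` of the Cartan matrix; summing over `i` and `j` gives
`N₁₃`.

That the `W_i` are pairwise non-isomorphic and that multiplicities are well defined both follow from
counting dimensions: `Hom(Y, F_0j W_r)` has dimension `c j r · dim End Y`, and the Cartan matrix `c`
is unitriangular (`IsCellSystem.eq_of_iso`, `IsCellSystem.multiplicity_unique`). -/

namespace ProjFun

open scoped MonoidalCategory

/-! ### Retracts, local endomorphism rings and indecomposable objects. -/

section KrullSchmidt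

variable {M : Type w} [Category.{v} M] [Preadditive M]

theorem exists_isUnit_of_sum_eq_one {R ι : Type*} [Ring R] [IsLocalRing R] (s : Finset ι)
    (f : ι → R) (h : ∑ a ∈ s, f a = 1) : ∃ a ∈ s, IsUnit (f a) := by
  classical
  -- The induction needs a sum that is merely a unit: after one term is split off, the remaining
  -- partial sum is a unit but not 1.
  suffices key : ∀ s : Finset ι, IsUnit (∑ a ∈ s, f a) → ∃ a ∈ s, IsUnit (f a) from
    key s (h ▸ isUnit_one)
  intro s
  induction s using Finset.induction_on with
  | empty => intro h; simp at h
  | insert a s ha ih =>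
    rintro ⟨u, hu⟩
    rw [Finset.sum_insert ha] at hu
    have h1 : ↑u⁻¹ * f a + ↑u⁻¹ * ∑ b ∈ s, f b = 1 := by rw [← mul_add, ← hu, Units.inv_mul]
    rcases IsLocalRing.isUnit_or_isUnit_of_add_one h1 with h2 | h2
    · exact ⟨a, Finset.mem_insert_self a s, (Units.isUnit_units_mul _ _).1 h2⟩
    · obtain ⟨b, hb, h3⟩ := ih ((Units.isUnit_units_mul _ _).1 h2)
      exact ⟨b, Finset.mem_insert_of_mem hb, h3⟩

/-- An object with local endomorphism ring through which the identity decomposes as a sum is a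
retract of one of the intermediate objects. -/
theorem exists_retract_of_sum {Z : M} [IsLocalRing (End Z)] {ι : Type*} [Fintype ι] {W : ι → M}
    (f : ∀ a, Z ⟶ W a) (g : ∀ a, W a ⟶ Z) (h : ∑ a, f a ≫ g a = 𝟙 Z) :
    ∃ a, Nonempty (Retract Z (W a)) := by
  obtain ⟨a, -, ha⟩ := exists_isUnit_of_sum_eq_one (R := End Z) Finset.univ
    (fun a => f a ≫ g a) h
  have := (isUnit_iff_isIso _).1 ha
  exact ⟨a, ⟨⟨f a, g a ≫ inv (f a ≫ g a), by rw [← Category.assoc, IsIso.hom_inv_id]⟩⟩⟩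

theorem not_isZero_of_isLocalRing {Z : M} [IsLocalRing (End Z)] : ¬ IsZero Z := fun h =>
  one_ne_zero (α := End Z) (h.eq_of_src _ _)

theorem isZero_of_retract {Z X : M} (r : Retract Z X) (h : IsZero X) : IsZero Z := by
  rw [IsZero.iff_id_eq_zero, ← r.retract, h.eq_of_tgt r.i 0, zero_comp]

variable [HasFiniteBiproducts M]

theorem exists_iso_biprod_of_retract (hI : IsIdempotentComplete M) {Z X : M} (r : Retract Z X) :
    ∃ K : M, Nonempty (X ≅ Z ⊞ K) := by
  -- The complement of `Z` is the image of the complementary idempotent `1 - r.r ≫ r.i`.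
  obtain ⟨K, i, q, h1, h2⟩ := hI.idempotents_split X (𝟙 X - r.r ≫ r.i) (by simp)
  have e1 : r.i ≫ q = 0 := by
    rw [← Category.comp_id q, ← h1, reassoc_of% h2]
    simp
  have e2 : i ≫ r.r = 0 := by
    rw [← Category.id_comp i, ← h1, Category.assoc, Category.assoc, reassoc_of% h2]
    simp
  exact ⟨K, ⟨biprod.uniqueUpToIso Z K (b := ⟨X, r.r, q, r.i, i, r.retract, e1, e2, h1⟩)
    (isBinaryBilimitOfTotal _ (by simp [h2]))⟩⟩

theorem iso_of_retract (hI : IsIdempotentComplete M) {Z X : M} (r : Retract Z X)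
    (hX : Indecomposable X) (hZ : ¬ IsZero Z) : Nonempty (X ≅ Z) := by
  obtain ⟨K, ⟨e⟩⟩ := exists_iso_biprod_of_retract hI r
  have hK : IsZero K := (hX.2 Z K e).resolve_left hZ
  exact ⟨e ≪≫ ⟨biprod.fst, biprod.inl,
    biprod.hom_ext _ _ (by simp) (hK.eq_of_tgt _ _), by simp⟩⟩

/-- A decomposition `P ⊞ Q` gives two idempotents with sum 1, one of which is a unit by locality.
That unit annihilates the inclusion of the other summand, which is therefore zero. -/
theorem indecomposable_of_isLocalRing {Z : M} [IsLocalRing (End Z)] : Indecomposable Z := by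
  refine ⟨not_isZero_of_isLocalRing, fun P Q e => ?_⟩
  by_contra! h
  let a : End Z := e.hom ≫ biprod.fst ≫ biprod.inl ≫ e.inv
  let b : End Z := e.hom ≫ biprod.snd ≫ biprod.inr ≫ e.inv
  have hab : a + b = 1 := by
    change e.hom ≫ biprod.fst ≫ biprod.inl ≫ e.inv + e.hom ≫ biprod.snd ≫ biprod.inr ≫ e.inv = 𝟙 Z
    have := congrArg (fun t => e.hom ≫ t ≫ e.inv) (biprod.total (X := P) (Y := Q))
    simpa only [Preadditive.add_comp, Preadditive.comp_add, Category.assoc, Category.id_comp,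
      Iso.hom_inv_id] using this
  rcases IsLocalRing.isUnit_or_isUnit_of_add_one hab with h1 | h1
  · have := (isUnit_iff_isIso _).1 h1
    refine h.2 ((IsZero.iff_id_eq_zero Q).2 ?_)
    have h2 : (biprod.inr ≫ e.inv) ≫ a = 0 := by simp [a]
    have h3 : biprod.inr ≫ e.inv = 0 := (cancel_mono a).1 (by rw [h2, zero_comp])
    have h4 : (biprod.inr ≫ e.inv) ≫ e.hom ≫ biprod.snd = 𝟙 Q := by simp
    rw [← h4, h3, zero_comp]
  · have := (isUnit_iff_isIso _).1 h1
    refine h.1 ((IsZero.iff_id_eq_zero P).2 ?_)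
    have h2 : (biprod.inl ≫ e.inv) ≫ b = 0 := by simp [b]
    have h3 : biprod.inl ≫ e.inv = 0 := (cancel_mono b).1 (by rw [h2, zero_comp])
    have h4 : (biprod.inl ≫ e.inv) ≫ e.hom ≫ biprod.fst = 𝟙 P := by simp
    rw [← h4, h3, zero_comp]

theorem IsFinitary.exists_local_retract {k : Type*} [Field k] [Linear k M] (hM : IsFinitary k M)
    {X : M} (hX : ¬ IsZero X) : ∃ Z : M, IsLocalRing (End Z) ∧ Nonempty (Retract Z X) := by
  obtain ⟨n, Z, hZ, ⟨e⟩⟩ := hM.krullSchmidt X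
  by_contra! h
  refine hX ((IsZero.iff_id_eq_zero _).2 ?_)
  -- Each summand of the Krull-Schmidt decomposition would be a retract of the excluded kind, so the
  -- decomposition is empty and `X` is zero.
  have hn : IsEmpty (Fin n) := ⟨fun a => (h (Z a) (hZ a)).false
    ⟨biproduct.ι Z a ≫ e.inv, e.hom ≫ biproduct.π Z a, by simp⟩⟩
  rw [← e.hom_inv_id, ← Category.id_comp e.inv, ← biproduct.total]
  simp

theorem IsFinitary.exists_local_iso {k : Type*} [Field k] [Linear k M] (hM : IsFinitary k M)
    {X : M} (hX : Indecomposable X) : ∃ Z : M, IsLocalRing (End Z) ∧ Nonempty (X ≅ Z) := by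
  obtain ⟨Z, hZ, ⟨r⟩⟩ := hM.exists_local_retract hX.1
  exact ⟨Z, hZ, iso_of_retract hM.idempotentComplete r hX not_isZero_of_isLocalRing⟩

end KrullSchmidt

/-! ### The Cartan matrix and the formal properties of the `F_ij`. -/

/-- The matrix with entries `dim eⱼ A eₛ`. -/
def cartan : Fin 3 → Fin 3 → ℕ := ![![1, 0, 0], ![1, 1, 0], ![0, 1, 1]]

theorem cartan_eq_zero_or_one (j s : Fin 3) : cartan j s = 0 ∨ cartan j s = 1 := by
  revert j s; decide

theorem cartan_self (i : Fin 3) : cartan i i = 1 := by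
  revert i; decide

/-- The properties of the 1-morphisms `Fᵢⱼ` which determine their action on a transitive faithful
2-representation. -/
structure IsCellSystem {𝒟 : Type*} [Category 𝒟] [Preadditive 𝒟] [MonoidalCategory 𝒟]
    (F : Fin 3 → Fin 3 → 𝒟) : Prop where
  -- In `𝒟` the left tensor factor acts first, so `F s l ⊗ F i j` stands for `F_ij ∘ F_sl`.
  comp_iso : ∀ s l i j, cartan j s = 1 → Nonempty (F s l ⊗ F i j ≅ F i l)
  comp_zero : ∀ s l i j, cartan j s = 0 → 𝟙 (F s l ⊗ F i j) = 0
  counit : ∀ i, ∃ ε : F i i ⟶ 𝟙_ 𝒟, ∀ l, IsIso (F i l ◁ ε)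
  ne_zero : 𝟙 (F 0 0) ≠ 0
  generate : ∀ G : 𝒟, ∃ (ι : Type) (_ : Fintype ι) (H : ι → 𝒟) (f : ∀ a, G ⟶ H a)
    (g : ∀ a, H a ⟶ G), (∀ a, H a = 𝟙_ 𝒟 ∨ ∃ i j, H a = F i j) ∧ ∑ a, f a ≫ g a = 𝟙 G

/-! ### The fixed object `Y` and the indecomposable objects `F_i0 Y`. -/

section Action

variable {k : Type*} [Field k]
variable {𝒟 : Type*} [Category 𝒟] [Preadditive 𝒟] [Linear k 𝒟] [MonoidalCategory 𝒟]
variable {M : Type w} [Category.{v} M] [Preadditive M] [Linear k M]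
variable (ρ : TwoRep k 𝒟 M)

/-- The action of a tensor product. -/
def TwoRep.tensorIso (G H : 𝒟) (Z : M) :
    (ρ.act.obj (G ⊗ H)).obj Z ≅ (ρ.act.obj H).obj ((ρ.act.obj G).obj Z) :=
  (Functor.Monoidal.μIso ρ.act G H).symm.app Z

/-- The action of the unit. -/
def TwoRep.unitIso (Z : M) : (ρ.act.obj (𝟙_ 𝒟)).obj Z ≅ Z :=
  (Functor.Monoidal.εIso ρ.act).symm.app Z

variable {F : Fin 3 → Fin 3 → 𝒟} (hF : IsCellSystem F)
include hF

theorem IsCellSystem.nonempty_iso {s l i j : Fin 3} (h : cartan j s = 1) (Z : M) :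
    Nonempty ((ρ.act.obj (F i j)).obj ((ρ.act.obj (F s l)).obj Z) ≅ (ρ.act.obj (F i l)).obj Z) := by
  obtain ⟨e⟩ := hF.comp_iso s l i j h
  exact ⟨(ρ.tensorIso _ _ Z).symm ≪≫ (ρ.act.mapIso e).app Z⟩

theorem IsCellSystem.isZero {s l i j : Fin 3} (h : cartan j s = 0) (Z : M) :
    IsZero ((ρ.act.obj (F i j)).obj ((ρ.act.obj (F s l)).obj Z)) := by
  refine IsZero.of_iso ?_ (ρ.tensorIso (F s l) (F i j) Z).symm
  rw [IsZero.iff_id_eq_zero, ← NatTrans.id_app, ← CategoryTheory.Functor.map_id,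
    hF.comp_zero s l i j h, Functor.map_zero]
  rfl

/-- Whiskering a natural transformation on the left by a functor means evaluating it at the values
of that functor. Invertibility of `F i l ◁ ε` thus becomes invertibility of the acting
transformation at all objects `F_il Z`. -/
theorem IsCellSystem.exists_counit (i : Fin 3) :
    ∃ η : ρ.act.obj (F i i) ⟶ 𝟭 M, ∀ l Z, IsIso (η.app ((ρ.act.obj (F i l)).obj Z)) := by
  obtain ⟨ε, hε⟩ := hF.counit i
  refine ⟨ρ.act.map ε ≫ (Functor.Monoidal.εIso ρ.act).inv, fun l Z => ?_⟩
  have := hε l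
  have h1 : IsIso (ρ.act.map (F i l ◁ ε)) := inferInstance
  -- The action commutes with whiskering only up to the coherence isomorphisms `μ` and `δ`, which do
  -- not affect invertibility.
  have h2 : ρ.act.obj (F i l) ◁ ρ.act.map ε = Functor.LaxMonoidal.μ ρ.act (F i l) (F i i) ≫
      ρ.act.map (F i l ◁ ε) ≫ Functor.OplaxMonoidal.δ ρ.act (F i l) (𝟙_ 𝒟) := by
    rw [Functor.Monoidal.map_whiskerLeft]
    simp only [Category.assoc, Functor.Monoidal.μ_δ, Functor.Monoidal.μ_δ_assoc, Category.comp_id]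
  have h3 : IsIso (ρ.act.obj (F i l) ◁ ρ.act.map ε) := by
    rw [h2]
    infer_instance
  have h4 : IsIso ((ρ.act.obj (F i l) ◁ ρ.act.map ε).app Z) := inferInstance
  have h5 : IsIso ((ρ.act.map ε).app ((ρ.act.obj (F i l)).obj Z)) := h4
  rw [NatTrans.comp_app]
  infer_instance

variable [HasFiniteBiproducts M]

/-- By naturality `η.app Y` is a retract, as an arrow, of the component at the larger object; the
inverse there is conjugated by the retraction. -/
theorem IsCellSystem.isIso_counit_of_retract {i l : Fin 3} {η : ρ.act.obj (F i i) ⟶ 𝟭 M}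
    {Y Z : M} [IsIso (η.app ((ρ.act.obj (F i l)).obj Z))]
    (r : Retract Y ((ρ.act.obj (F i l)).obj Z)) : IsIso (η.app Y) := by
  refine ⟨r.i ≫ inv (η.app ((ρ.act.obj (F i l)).obj Z)) ≫ (ρ.act.obj (F i i)).map r.r, ?_, ?_⟩
  · have := η.naturality r.i
    simp only [Functor.id_map] at this
    rw [← reassoc_of% this, IsIso.hom_inv_id_assoc, ← Functor.map_comp, r.retract,
      CategoryTheory.Functor.map_id]
  · have := η.naturality r.r
    simp only [Functor.id_map] at this
    simp only [Category.assoc]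
    rw [this, IsIso.inv_hom_id_assoc, r.retract]
    rfl

/-- An indecomposable object which is fixed by `F₁₁`. -/
theorem IsCellSystem.exists_fixed (hM : IsFinitary k M) (hfaithful : ρ.IsFaithful) :
    ∃ Y : M, IsLocalRing (End Y) ∧ Nonempty ((ρ.act.obj (F 0 0)).obj Y ≅ Y) := by
  have : ρ.act.Faithful := hfaithful
  -- If all values of `F_00` were zero, faithfulness would force the identity 2-morphism of `F_00`
  -- to vanish.
  obtain ⟨Z, hZ⟩ : ∃ Z, ¬ IsZero ((ρ.act.obj (F 0 0)).obj Z) := by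
    by_contra! h
    refine hF.ne_zero (ρ.act.map_injective ?_)
    rw [Functor.map_zero]
    ext Z
    exact (h Z).eq_of_src _ _
  obtain ⟨Y, hY, ⟨r⟩⟩ := hM.exists_local_retract hZ
  obtain ⟨η, hη⟩ := hF.exists_counit ρ 0
  have := hη 0 Z
  have := hF.isIso_counit_of_retract ρ (η := η) r
  exact ⟨Y, hY, ⟨asIso (η.app Y)⟩⟩

section Fixed

variable {Y : M} [IsLocalRing (End Y)] (eY : (ρ.act.obj (F 0 0)).obj Y ≅ Y)
include eY

theorem IsCellSystem.nonempty_iso_fixed (i : Fin 3) :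
    Nonempty ((ρ.act.obj (F 0 i)).obj ((ρ.act.obj (F i 0)).obj Y) ≅ Y) := by
  obtain ⟨e⟩ := hF.nonempty_iso ρ (i := 0) (l := 0) (cartan_self i) Y
  exact ⟨e ≪≫ eY⟩

/-- `F_0i` carries a decomposition of `F_i0 Y` to one of `Y`, so it kills one of the two summands.
That summand is then zero, because `F_0i` detects zero summands of `F_i0 Y`. -/
theorem IsCellSystem.indecomposable (i : Fin 3) :
    Indecomposable ((ρ.act.obj (F i 0)).obj Y) := by
  have := ρ.obj_additive (F 0 i)
  have := ρ.obj_additive (F i 0)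
  obtain ⟨e⟩ := hF.nonempty_iso_fixed ρ eY i
  obtain ⟨η, hη⟩ := hF.exists_counit ρ i
  have := hη 0 Y
  -- The counit gives `Q ≅ F_ii Q`, and `F_ii Q ≅ F_i0 F_0i Q` because `e_0 A e_0` is
  -- one-dimensional.
  have key : ∀ Q, Retract Q ((ρ.act.obj (F i 0)).obj Y) → IsZero ((ρ.act.obj (F 0 i)).obj Q) →
      IsZero Q := fun Q r hQ => by
    have h1 := hF.isIso_counit_of_retract ρ (η := η) r
    obtain ⟨f⟩ := hF.nonempty_iso ρ (i := i) (l := i) (cartan_self 0) Q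
    exact (((ρ.act.obj (F i 0)).map_isZero hQ).of_iso f.symm).of_iso (asIso (η.app Q)).symm
  refine ⟨fun h => not_isZero_of_isLocalRing
    (((ρ.act.obj (F 0 i)).map_isZero h).of_iso e.symm), fun P Q f => ?_⟩
  have := preservesBinaryBiproduct_of_preservesBiproduct (ρ.act.obj (F 0 i)) P Q
  have hY : Indecomposable Y := indecomposable_of_isLocalRing
  rcases hY.2 _ _ (e.symm ≪≫ (ρ.act.obj (F 0 i)).mapIso f ≪≫ (ρ.act.obj (F 0 i)).mapBiprod P Q)
    with h | h
  · exact .inl (key P ⟨biprod.inl ≫ f.inv, f.hom ≫ biprod.fst, by simp⟩ h)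
  · exact .inr (key Q ⟨biprod.inr ≫ f.inv, f.hom ≫ biprod.snd, by simp⟩ h)

/-- Transitivity makes `Z` a summand of some `G Y`. Since the identity of `G` is a sum of maps
through the unit and the `F_ij`, locality of the endomorphism ring makes `Z` a summand of `Y` or of
a single `F_ij Y`. -/
theorem IsCellSystem.complete (hM : IsFinitary k M) (htrans : ρ.IsTransitive) {Z : M}
    (hZ : Indecomposable Z) : ∃ i, Nonempty (Z ≅ (ρ.act.obj (F i 0)).obj Y) := by
  obtain ⟨Z', hZ', ⟨e⟩⟩ := hM.exists_local_iso hZ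
  obtain ⟨G, K, ⟨f⟩⟩ := htrans Y Z indecomposable_of_isLocalRing hZ
  obtain ⟨ι, _, H, p, q, hH, hs⟩ := hF.generate G
  let r : Retract Z' ((ρ.act.obj G).obj Y) :=
    ⟨e.inv ≫ biprod.inl ≫ f.inv, f.hom ≫ biprod.fst ≫ e.hom, by simp⟩
  have hs' : ∑ a, (r.i ≫ (ρ.act.map (p a)).app Y) ≫ (ρ.act.map (q a)).app Y ≫ r.r = 𝟙 Z' := by
    have h1 := congrArg (fun t => (ρ.act.map t).app Y) hs
    simp only [Functor.map_sum, CategoryTheory.Functor.map_id, NatTrans.id_app, Functor.map_comp,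
      NatTrans.app_sum, NatTrans.comp_app] at h1
    rw [← r.retract]
    conv_rhs => rw [← Category.comp_id r.i, ← h1]
    simp only [Preadditive.comp_sum, Preadditive.sum_comp, Category.assoc]
  obtain ⟨a, ⟨t⟩⟩ := exists_retract_of_sum _ _ hs'
  have hW : ∀ i, Retract Z' ((ρ.act.obj (F i 0)).obj Y) →
      Nonempty (Z ≅ (ρ.act.obj (F i 0)).obj Y) := fun i t => by
    obtain ⟨e'⟩ := iso_of_retract hM.idempotentComplete t (hF.indecomposable ρ eY i)
      not_isZero_of_isLocalRing
    exact ⟨e ≪≫ e'.symm⟩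
  rcases hH a with h | ⟨i, j, h⟩
  · rw [h] at t
    exact ⟨0, hW 0 (t.trans (.ofIso (ρ.unitIso Y ≪≫ eY.symm)))⟩
  · rw [h] at t
    -- Replacing `Y` by `F_00 Y` turns `F_ij Y` into a composite, which is either zero or `F_i0 Y`;
    -- the first is impossible for an object with a non-zero retract.
    have t' := t.trans (.ofIso ((ρ.act.obj (F i j)).mapIso eY.symm))
    rcases cartan_eq_zero_or_one j 0 with hj | hj
    · exact absurd (isZero_of_retract t' (hF.isZero ρ hj Y)) not_isZero_of_isLocalRing
    · obtain ⟨e'⟩ := hF.nonempty_iso ρ (i := i) (l := 0) hj Y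
      exact ⟨i, hW i (t'.trans (.ofIso e'))⟩

end Fixed

end Action

/-! ### Morphisms into biproducts and regrouping of index sets. -/

section Multiplicities

variable {M : Type w} [Category.{v} M] [Preadditive M]

/-- Morphisms into the image of a finite biproduct under an additive functor. -/
noncomputable def homMapBiproductEquiv (k : Type*) [Field k] [Linear k M]
    [HasFiniteBiproducts M] (Y : M) (G : M ⥤ M) [G.Additive] {ι : Type} [Fintype ι] (f : ι → M) :
    (Y ⟶ G.obj (⨁ f)) ≃ₗ[k] (∀ p, Y ⟶ G.obj (f p)) where
  toFun t p := t ≫ G.map (biproduct.π f p)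
  map_add' s t := by ext p; simp
  map_smul' c t := by ext p; simp
  invFun s := ∑ p, s p ≫ G.map (biproduct.ι f p)
  left_inv t := by
    simp only [Category.assoc, ← Functor.map_comp]
    rw [← Preadditive.comp_sum, ← Functor.map_sum, biproduct.total,
      CategoryTheory.Functor.map_id, Category.comp_id]
  right_inv s := by
    classical
    ext p
    simp only [Preadditive.sum_comp, Category.assoc, ← Functor.map_comp]
    rw [Finset.sum_eq_single p (fun q _ hq => by rw [biproduct.ι_π_ne _ hq]; simp) (by simp)]
    simp

variable [HasFiniteBiproducts M]

theorem isZero_biproduct_of_isEmpty {ι : Type} [Finite ι] [IsEmpty ι] (f : ι → M) :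
    IsZero (⨁ f) := by
  have := Fintype.ofFinite ι
  rw [IsZero.iff_id_eq_zero, ← biproduct.total]
  simp

/-- Regrouping of an index set by the first coordinate. -/
def sigmaProdFinEquiv {m n : ℕ} (c : Fin n → ℕ) :
    (Σ p : Fin m × Fin n, Fin (c p.2)) ≃ (Σ _ : Fin m, Fin (∑ j, c j)) where
  toFun p := ⟨p.1.1, finSigmaFinEquiv ⟨p.1.2, p.2⟩⟩
  invFun p := ⟨(p.1, (finSigmaFinEquiv.symm p.2).1), (finSigmaFinEquiv.symm p.2).2⟩
  left_inv := by
    rintro ⟨⟨i, j⟩, x⟩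
    have := finSigmaFinEquiv.symm_apply_apply (⟨j, x⟩ : Σ j, Fin (c j))
    simp only
    rw [this]
  right_inv := by
    rintro ⟨i, y⟩
    exact congrArg (Sigma.mk i) (finSigmaFinEquiv.apply_symm_apply y)

/-- An index set concentrated in one fibre. -/
noncomputable def sigmaIteFinEquiv {m : ℕ} (i : Fin m) (c : ℕ) :
    Fin c ≃ (Σ r : Fin m, Fin (if r = i then c else 0)) :=
  Equiv.ofBijective (fun x => ⟨i, Fin.cast (by simp) x⟩) ⟨fun x y h => by
    simpa using h, fun ⟨r, y⟩ => by
      by_cases h : r = i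
      · subst h
        exact ⟨Fin.cast (by simp) y, by simp⟩
      · exact (Fin.cast (by simp [h]) y : Fin 0).elim0⟩

end Multiplicities

/-! ### The matrices of the action and uniqueness of multiplicities. -/

section Matrices

variable {k : Type*} [Field k]
variable {𝒟 : Type*} [Category 𝒟] [Preadditive 𝒟] [Linear k 𝒟] [MonoidalCategory 𝒟]
variable {M : Type w} [Category.{v} M] [Preadditive M] [Linear k M] [HasFiniteBiproducts M]
variable (ρ : TwoRep k 𝒟 M) {F : Fin 3 → Fin 3 → 𝒟} (hF : IsCellSystem F)
variable {Y : M} (eY : (ρ.act.obj (F 0 0)).obj Y ≅ Y)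
variable {W : Fin 3 → M} (eW : ∀ i, (ρ.act.obj (F i 0)).obj Y ≅ W i)
include hF eW

/-- Since `W s` is `F_s0 Y`, this is the composition rule applied to `F_ij F_s0 Y`. A Cartan entry 0
or 1 leaves only an empty or a one-term biproduct. -/
theorem IsCellSystem.nonempty_iso_biproduct (i j s : Fin 3) :
    Nonempty ((ρ.act.obj (F i j)).obj (W s) ≅ ⨁ fun _ : Fin (cartan j s) => W i) := by
  rcases cartan_eq_zero_or_one j s with h | h
  · rw [h]
    exact ⟨((hF.isZero ρ h Y).of_iso ((ρ.act.obj (F i j)).mapIso (eW s).symm)).iso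
      (isZero_biproduct_of_isEmpty _)⟩
  · rw [h]
    obtain ⟨e⟩ := hF.nonempty_iso ρ (i := i) (l := 0) h Y
    exact ⟨(ρ.act.obj (F i j)).mapIso (eW s).symm ≪≫ e ≪≫ eW i ≪≫
      (biproductUniqueIso fun _ : Fin 1 => W i).symm⟩

theorem IsCellSystem.hasMatrix (i j : Fin 3) :
    ρ.HasMatrix W (F i j) (fun r s => if r = i then cartan j s else 0) := fun s => by
  obtain ⟨e⟩ := hF.nonempty_iso_biproduct ρ eW i j s
  exact ⟨e ≪≫ biproduct.whiskerEquiv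
    (g := fun p : (Σ r, Fin (if r = i then cartan j s else 0)) => W p.1)
    (sigmaIteFinEquiv i (cartan j s)) fun _ => Iso.refl (W i)⟩

/-- Evaluating the action at `W s` is additive in the 1-morphism, so it preserves the biproduct of
the `F_ij`. Collecting the copies of `W i` over all `j` gives a column sum of the Cartan matrix, the
same in every row. -/
theorem IsCellSystem.hasMatrix_biproduct
    (B : Bicone fun p : Fin 3 × Fin 3 => F p.1 p.2) (hB : B.IsBilimit) :
    ρ.HasMatrix W B.pt (fun _ s => ∑ j, cartan j s) := fun s => by
  have e := fun p : Fin 3 × Fin 3 => (hF.nonempty_iso_biproduct ρ eW p.1 p.2 s).some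
  have e' := biproduct.uniqueUpToIso _
    (isBilimitOfPreserves (ρ.act ⋙ (evaluation M M).obj (W s)) hB)
  exact ⟨e' ≪≫ biproduct.mapIso e ≪≫ biproductBiproductIso (fun p : Fin 3 × Fin 3 =>
      Fin (cartan p.2 s)) (fun p _ => W p.1) ≪≫
    biproduct.whiskerEquiv (g := fun p : (Σ _ : Fin 3, Fin (∑ j, cartan j s)) => W p.1)
      (sigmaProdFinEquiv fun j => cartan j s) fun p => Iso.refl (W p.1.1)⟩

include eY

/-- `F_0j W_r` is either zero or isomorphic to `F_00 Y ≅ Y`. These dimensions serve as the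
invariants which separate the `W r` and recover multiplicities. -/
theorem IsCellSystem.finrank_hom (j r : Fin 3) :
    Module.finrank k (Y ⟶ (ρ.act.obj (F 0 j)).obj (W r)) =
      cartan j r * Module.finrank k (Y ⟶ Y) := by
  rcases cartan_eq_zero_or_one j r with h | h
  · have h0 := (hF.isZero ρ (i := 0) (l := 0) h Y).of_iso
      ((ρ.act.obj (F 0 j)).mapIso (eW r).symm)
    have : Subsingleton (Y ⟶ (ρ.act.obj (F 0 j)).obj (W r)) := ⟨fun a b => h0.eq_of_tgt a b⟩
    rw [h, Module.finrank_zero_of_subsingleton, zero_mul]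
  · obtain ⟨e⟩ := hF.nonempty_iso ρ (i := 0) (l := 0) h Y
    rw [h, one_mul]
    exact (Linear.homCongr k (Iso.refl Y)
      ((ρ.act.obj (F 0 j)).mapIso (eW r).symm ≪≫ e ≪≫ eY)).finrank_eq

theorem IsCellSystem.finrank_hom_biproduct (hM : IsFinitary k M) (c : Fin 3 → ℕ) (j : Fin 3) :
    Module.finrank k (Y ⟶ (ρ.act.obj (F 0 j)).obj (⨁ fun p : (Σ i, Fin (c i)) => W p.1)) =
      (∑ r, c r * cartan j r) * Module.finrank k (Y ⟶ Y) := by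
  have := hM.finite_hom
  have := ρ.obj_additive (F 0 j)
  rw [(homMapBiproductEquiv k Y (ρ.act.obj (F 0 j)) _).finrank_eq, Module.finrank_pi_fintype,
    Fintype.sum_sigma, Finset.sum_mul]
  refine Finset.sum_congr rfl fun r _ => ?_
  simp only [hF.finrank_hom ρ eY eW, Finset.sum_const, Finset.card_univ, Fintype.card_fin,
    smul_eq_mul, mul_assoc]

variable [IsLocalRing (End Y)]

theorem IsCellSystem.finrank_end_pos (hM : IsFinitary k M) : 0 < Module.finrank k (Y ⟶ Y) := by
  have := hM.finite_hom
  have : Nontrivial (Y ⟶ Y) := inferInstanceAs (Nontrivial (End Y))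
  exact Module.finrank_pos

/-- The dimensions of `Hom(Y, F_0j -)` determine the product of the Cartan matrix with the
multiplicity vector, once the positive factor `dim End Y` is cancelled. -/
theorem IsCellSystem.multiplicity_unique (hM : IsFinitary k M) {c c' : Fin 3 → ℕ}
    (e : (⨁ fun p : (Σ i, Fin (c i)) => W p.1) ≅ ⨁ fun p : (Σ i, Fin (c' i)) => W p.1) :
    c = c' := by
  have key : ∀ j, ∑ r, c r * cartan j r = ∑ r, c' r * cartan j r := fun j => by
    have h := (Linear.homCongr k (Iso.refl Y) ((ρ.act.obj (F 0 j)).mapIso e)).finrank_eq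
    rw [hF.finrank_hom_biproduct ρ eY eW hM, hF.finrank_hom_biproduct ρ eY eW hM] at h
    exact Nat.eq_of_mul_eq_mul_right (hF.finrank_end_pos ρ eY eW hM) h
  have h0 := key 0
  have h1 := key 1
  have h2 := key 2
  -- The three equations fix `c 0`, `c 0 + c 1` and `c 1 + c 2`, hence all of `c`.
  simp [Fin.sum_univ_three, cartan] at h0 h1 h2
  funext r
  fin_cases r <;> simp <;> omega

theorem IsCellSystem.hasMatrix_iff (hM : IsFinitary k M) {G : 𝒟} {N : Matrix (Fin 3) (Fin 3) ℕ}
    (hN : ρ.HasMatrix W G N) (N' : Matrix (Fin 3) (Fin 3) ℕ) :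
    ρ.HasMatrix W G N' ↔ N' = N := by
  refine ⟨fun h => ?_, fun h => h ▸ hN⟩
  ext r s
  obtain ⟨e⟩ := hN s
  obtain ⟨e'⟩ := h s
  exact congrFun (hF.multiplicity_unique ρ eY eW hM (c := fun r => N' r s) (c' := fun r => N r s)
    (e'.symm ≪≫ e)) r

/-- The dimension invariants of `W i` form column `i` of the Cartan matrix, and its three columns
are distinct. -/
theorem IsCellSystem.eq_of_iso (hM : IsFinitary k M) {i j : Fin 3} (e : W i ≅ W j) : i = j := by
  have h : ∀ l, cartan l i = cartan l j := fun l => by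
    have h := (Linear.homCongr k (Iso.refl Y) ((ρ.act.obj (F 0 l)).mapIso e)).finrank_eq
    rw [hF.finrank_hom ρ eY eW, hF.finrank_hom ρ eY eW] at h
    exact Nat.eq_of_mul_eq_mul_right (hF.finrank_end_pos ρ eY eW hM) h
  revert h
  clear e
  revert i j
  decide

end Matrices

/-! ### Comparison with the explicit matrices and the choice of the ordering. -/

theorem cellMatrix_eq (i j : Fin 3) :
    cellMatrix i j = fun r s => if r = i then cartan j s else 0 := by
  ext r s
  fin_cases i <;> fin_cases j <;> fin_cases r <;> fin_cases s <;> rfl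

theorem N₁₃_eq : N₁₃ = fun _ s => ∑ j, cartan j s := by
  ext r s
  fin_cases r <;> fin_cases s <;> rfl

theorem IsCellSystem.exists_ordering {k : Type*} [Field k]
    {𝒟 : Type*} [Category 𝒟] [Preadditive 𝒟] [Linear k 𝒟] [MonoidalCategory 𝒟]
    {M : Type w} [Category.{v} M] [Preadditive M] [Linear k M] [HasFiniteBiproducts M]
    (ρ : TwoRep k 𝒟 M) {F : Fin 3 → Fin 3 → 𝒟} (hF : IsCellSystem F) (hM : IsFinitary k M)
    (htrans : ρ.IsTransitive) (hfaithful : ρ.IsFaithful)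
    (B : Bicone fun p : Fin 3 × Fin 3 => F p.1 p.2) (hB : B.IsBilimit)
    {n : ℕ} {X : Fin n → M} (hX : IsIndecList X) :
    ∃ σ : Fin 3 ≃ Fin n, (∀ N, ρ.HasMatrix (X ∘ σ) B.pt N ↔ N = N₁₃) ∧
      ∀ i j N, ρ.HasMatrix (X ∘ σ) (F i j) N ↔ N = cellMatrix i j := by
  obtain ⟨Y, hY, ⟨eY⟩⟩ := hF.exists_fixed ρ hM hfaithful
  -- `σ i` is the position in the given list of the representative of `F_i0 Y`.
  choose σ eσ using fun i => hX.complete _ (hF.indecomposable ρ eY i)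
  have eW : ∀ i, (ρ.act.obj (F i 0)).obj Y ≅ X (σ i) := fun i => (eσ i).some
  have hσ : Function.Bijective σ := by
    refine ⟨fun i j h => ?_, fun m => ?_⟩
    · exact hF.eq_of_iso ρ eY (W := X ∘ σ) eW hM (eqToIso (congrArg X h))
    · obtain ⟨i, ⟨e⟩⟩ := hF.complete ρ eY hM htrans (hX.indecomposable m)
      exact ⟨i, (hX.irredundant _ _ ⟨e ≪≫ eW i⟩).symm⟩
  refine ⟨Equiv.ofBijective σ hσ, fun N => ?_, fun i j N => ?_⟩
  · rw [N₁₃_eq]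
    exact hF.hasMatrix_iff ρ eY (W := X ∘ σ) eW hM
      (hF.hasMatrix_biproduct ρ (W := X ∘ σ) eW B hB) N
  · rw [cellMatrix_eq]
    exact hF.hasMatrix_iff ρ eY (W := X ∘ σ) eW hM (hF.hasMatrix ρ (W := X ∘ σ) eW i j) N

/-! ### Tensor products of the bimodules `A e ⊗_k f A`, and the multiplication map. -/

section IdempotentBimodules

variable (k : Type*) [Field k] {A : Type u} [Ring A] [Algebra k A]

section OuterMap

variable {L L' R R' : Type*}
variable [AddCommGroup L] [Module k L] [Module A L] [IsScalarTower k A L]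
variable [AddCommGroup L'] [Module k L'] [Module A L'] [IsScalarTower k A L']
variable [AddCommGroup R] [Module k R] [Module Aᵐᵒᵖ R] [IsScalarTower k Aᵐᵒᵖ R]
variable [AddCommGroup R'] [Module k R'] [Module Aᵐᵒᵖ R'] [IsScalarTower k Aᵐᵒᵖ R']

/-- Functoriality of `L ⊗_k R`, as an additive map. -/
def outerAddMap (p : L →ₗ[A] L') (q : R →ₗ[Aᵐᵒᵖ] R') : Outer k A L R →+ Outer k A L' R' :=
  (TensorProduct.map (p.restrictScalars k) (q.restrictScalars k) :
    L ⊗[k] R →ₗ[k] L' ⊗[k] R').toAddMonoidHom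

theorem outerAddMap_tmul (p : L →ₗ[A] L') (q : R →ₗ[Aᵐᵒᵖ] R') (l : L) (r : R) :
    outerAddMap k p q (Outer.tmul k A l r) = Outer.tmul k A (p l) (q r) := rfl

/-- Functoriality of `L ⊗_k R`. -/
def outerMap (p : L →ₗ[A] L') (q : R →ₗ[Aᵐᵒᵖ] R') :
    BimHom A (Outer k A L R) (Outer k A L' R') where
  toLin :=
    { outerAddMap k p q with
      map_smul' := fun a t => by
        change outerAddMap k p q (a • t) = a • outerAddMap k p q t
        induction t using Outer.induction with
        | h0 => simp only [smul_zero, map_zero]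
        | h1 l r => simp only [Outer.smul_tmul, outerAddMap_tmul, map_smul]
        | h2 s t hs ht => simp only [smul_add, map_add, hs, ht] }
  map_right a t := by
    change outerAddMap k p q (op a • t) = op a • outerAddMap k p q t
    induction t using Outer.induction with
    | h0 => simp only [smul_zero, map_zero]
    | h1 l r => simp only [Outer.op_smul_tmul, outerAddMap_tmul, map_smul]
    | h2 s t hs ht => simp only [smul_add, map_add, hs, ht]

end OuterMap

/-- The left ideal `A e`. -/
abbrev LeftIdeal (e : A) : Submodule A A := Submodule.span A {e}

/-- The right ideal `f A`. -/
abbrev RightIdeal (f : A) : Submodule Aᵐᵒᵖ A := Submodule.span Aᵐᵒᵖ {f}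

theorem mul_of_mem_leftIdeal {e x : A} (he : IsIdempotentElem e) (hx : x ∈ LeftIdeal e) :
    x * e = x := by
  obtain ⟨a, rfl⟩ := Submodule.mem_span_singleton.1 hx
  rw [smul_eq_mul, mul_assoc, he.eq]

theorem mul_of_mem_rightIdeal {f y : A} (hf : IsIdempotentElem f) (hy : y ∈ RightIdeal f) :
    f * y = y := by
  obtain ⟨a, rfl⟩ := Submodule.mem_span_singleton.1 hy
  change f * (f * a.unop) = f * a.unop
  rw [← mul_assoc, hf.eq]

/-- Right multiplication by `e`, as a map to the left ideal `A e`. -/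
def toLeftIdeal (e : A) : A →ₗ[A] LeftIdeal e :=
  LinearMap.toSpanSingleton A _ ⟨e, Submodule.mem_span_singleton_self e⟩

@[simp] theorem coe_toLeftIdeal (e x : A) : (toLeftIdeal e x : A) = x * e := rfl

/-- Left multiplication by `f`, as a map to the right ideal `f A`. -/
def toRightIdeal (f : A) : A →ₗ[Aᵐᵒᵖ] RightIdeal f where
  toFun x := op x • ⟨f, Submodule.mem_span_singleton_self f⟩
  map_add' x y := by rw [MulOpposite.op_add, add_smul]
  map_smul' b x := by rw [RingHom.id_apply, smul_smul]; rfl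

@[simp] theorem coe_toRightIdeal (f x : A) : (toRightIdeal f x : A) = f * x := rfl

/-- The bimodule `A e ⊗_k f A`. -/
abbrev IdemOuter (e f : A) : Type u := Outer k A (LeftIdeal e) (RightIdeal f)

/-- The inclusion of `A e ⊗_k f A` into `A ⊗_k A`. -/
def inclIdem (e f : A) : BimHom A (IdemOuter k e f) (Outer k A A A) :=
  outerMap k (LeftIdeal e).subtype (RightIdeal f).subtype

/-- The projection from `A ⊗_k A` to `A e ⊗_k f A`. -/
def projIdem (e f : A) : BimHom A (Outer k A A A) (IdemOuter k e f) :=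
  outerMap k (toLeftIdeal e) (toRightIdeal f)

theorem inclIdem_tmul (e f : A) (x : LeftIdeal e) (y : RightIdeal f) :
    (inclIdem k e f).toLin (Outer.tmul k A x y) = Outer.tmul k A (x : A) (y : A) := rfl

theorem projIdem_tmul (e f x y : A) :
    (projIdem k e f).toLin (Outer.tmul k A x y) =
      Outer.tmul k A (toLeftIdeal e x) (toRightIdeal f y) := rfl

theorem toLeftIdeal_coe {e : A} (he : IsIdempotentElem e) (x : LeftIdeal e) :
    toLeftIdeal e (x : A) = x :=
  Subtype.ext (mul_of_mem_leftIdeal he x.2)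

theorem toRightIdeal_coe {f : A} (hf : IsIdempotentElem f) (y : RightIdeal f) :
    toRightIdeal f (y : A) = y :=
  Subtype.ext (mul_of_mem_rightIdeal hf y.2)

/-- The summand for a pair `(i, j)` sends `x ⊗ y` to `x e_i ⊗ e_j y`, and both families of
idempotents sum to 1. -/
theorem sum_inclIdem_projIdem {ι : Type*} [Fintype ι] (e : ι → A) (he : ∑ i, e i = 1)
    (t : Outer k A A A) :
    ∑ p : ι × ι, (inclIdem k (e p.1) (e p.2)).toLin ((projIdem k (e p.1) (e p.2)).toLin t) = t := by
  induction t using Outer.induction with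
  | h0 => simp
  | h1 x y =>
    simp only [projIdem_tmul, inclIdem_tmul, coe_toLeftIdeal, coe_toRightIdeal]
    rw [Fintype.sum_prod_type]
    change ∑ i, ∑ j, (x * e i) ⊗ₜ[k] (e j * y) = x ⊗ₜ[k] y
    simp only [← TensorProduct.tmul_sum, ← TensorProduct.sum_tmul, ← Finset.sum_mul,
      ← Finset.mul_sum, he, mul_one, one_mul]
  | h2 s t hs ht =>
    simp only [map_add, Finset.sum_add_distrib, hs, ht]

section Contraction

variable (e f f' g : A)

/-- The map `(x ⊗ y) ⊗ (z ⊗ w) ↦ φ (y z) x ⊗ w`. -/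
def contractIdem (φ : A →ₗ[k] k) :
    BimHom A (BalTensor A (IdemOuter k e f) (IdemOuter k f' g)) (IdemOuter k e g) :=
  (projIdem k e g).comp ((contractHom k φ).comp ((inclIdem k e f).tensor (inclIdem k f' g)))

/-- The map `x ⊗ w ↦ (x ⊗ f c) ⊗ (f' ⊗ w)`. -/
def expandIdem (c : A) :
    BimHom A (IdemOuter k e g) (BalTensor A (IdemOuter k e f) (IdemOuter k f' g)) :=
  ((projIdem k e f).tensor (projIdem k f' g)).comp ((expand k c).comp (inclIdem k e g))

variable {e f f' g}

theorem contractIdem_tmul (he : IsIdempotentElem e) (hg : IsIdempotentElem g) (φ : A →ₗ[k] k)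
    (x : LeftIdeal e) (y : RightIdeal f) (z : LeftIdeal f') (w : RightIdeal g) :
    (contractIdem k e f f' g φ).toLin (BalTensor.tmul A (Outer.tmul k A x y) (Outer.tmul k A z w)) =
      Outer.tmul k A (φ ((y : A) * z) • x) w := by
  change (projIdem k e g).toLin ((contractHom k φ).toLin
    (BalTensor.tmul A (Outer.tmul k A (x : A) (y : A)) (Outer.tmul k A (z : A) (w : A)))) = _
  rw [contractHom_tmul, projIdem_tmul, toRightIdeal_coe hg]
  congr 1
  exact toLeftIdeal_coe he (φ ((y : A) * z) • x)

theorem expandIdem_tmul (he : IsIdempotentElem e) (hg : IsIdempotentElem g) (c : A)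
    (x : LeftIdeal e) (w : RightIdeal g) :
    (expandIdem k e f f' g c).toLin (Outer.tmul k A x w) =
      BalTensor.tmul A (Outer.tmul k A x (toRightIdeal f c))
        (Outer.tmul k A (toLeftIdeal f' 1) w) := by
  change BalTensor.tmul A (Outer.tmul k A (toLeftIdeal e (x : A)) (toRightIdeal f c))
    (Outer.tmul k A (toLeftIdeal f' 1) (toRightIdeal g (w : A))) = _
  rw [toLeftIdeal_coe he, toRightIdeal_coe hg]

/-- Expanding and then contracting multiplies `x ⊗ w` by the scalar `φ (f c f')`. -/
theorem contractIdem_expandIdem (he : IsIdempotentElem e) (hg : IsIdempotentElem g)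
    {φ : A →ₗ[k] k} {c : A} (hφ : φ (f * c * f') = 1) (t : IdemOuter k e g) :
    (contractIdem k e f f' g φ).toLin ((expandIdem k e f f' g c).toLin t) = t := by
  induction t using Outer.induction with
  | h0 => simp only [map_zero]
  | h1 x w =>
    rw [expandIdem_tmul k he hg, contractIdem_tmul k he hg, coe_toRightIdeal, coe_toLeftIdeal,
      one_mul, hφ, one_smul]
  | h2 s t hs ht => simp only [map_add, hs, ht]

/-- Normal form: since `z = z f'`, the factor `z` slides across the tensor sign over `A` and leaves
`f'` behind. -/
theorem tmul_tmul_eq (hf' : IsIdempotentElem f')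
    (x : LeftIdeal e) (y : RightIdeal f) (z : LeftIdeal f') (w : RightIdeal g) :
    BalTensor.tmul A (Outer.tmul k A x y) (Outer.tmul k A z w) =
      BalTensor.tmul A (Outer.tmul k A x (op (z : A) • y))
        (Outer.tmul k A (toLeftIdeal f' 1) w) := by
  rw [← Outer.op_smul_tmul, BalTensor.op_smul_tmul, Outer.smul_tmul]
  congr 2
  exact Subtype.ext (by simp [mul_of_mem_leftIdeal hf' z.2])

/-- In normal form the middle factor is `y z`, an element of `f A f'`. By hypothesis it equals `φ (y
z)` times `f c`, and the scalar moves to the factor `x`. -/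
theorem expandIdem_contractIdem (he : IsIdempotentElem e) (hf : IsIdempotentElem f)
    (hf' : IsIdempotentElem f') (hg : IsIdempotentElem g)
    {φ : A →ₗ[k] k} {c : A} (hφ : ∀ a, f * a * f' = φ (f * a * f') • (f * c))
    (t : BalTensor A (IdemOuter k e f) (IdemOuter k f' g)) :
    (expandIdem k e f f' g c).toLin ((contractIdem k e f f' g φ).toLin t) = t := by
  induction t using BalTensor.induction with
  | h0 => simp only [map_zero]
  | h2 s t hs ht => simp only [map_add, hs, ht]
  | h1 s u =>
    induction s using Outer.induction with
    | h0 => simp only [BalTensor.zero_tmul, map_zero]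
    | h2 s t hs ht => simp only [BalTensor.add_tmul, map_add, hs, ht]
    | h1 x y =>
      induction u using Outer.induction with
      | h0 => simp only [BalTensor.tmul_zero, map_zero]
      | h2 s t hs ht => simp only [BalTensor.tmul_add, map_add, hs, ht]
      | h1 z w =>
        have h1 : f * ((y : A) * z) * f' = (y : A) * z := by
          rw [← mul_assoc, mul_of_mem_rightIdeal hf y.2, mul_assoc, mul_of_mem_leftIdeal hf' z.2]
        have h2 := hφ ((y : A) * z)
        rw [h1] at h2
        rw [contractIdem_tmul k he hg, expandIdem_tmul k he hg, tmul_tmul_eq k hf' x y z w,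
          Outer.smul_tmul_comm]
        congr 2
        exact Subtype.ext h2.symm

theorem subsingleton_balTensor (hf : IsIdempotentElem f) (hf' : IsIdempotentElem f')
    (h : ∀ a, f * a * f' = 0) :
    Subsingleton (BalTensor A (IdemOuter k e f) (IdemOuter k f' g)) := by
  refine subsingleton_of_forall_eq 0 fun t => ?_
  induction t using BalTensor.induction with
  | h0 => rfl
  | h2 s t hs ht => rw [hs, ht, add_zero]
  | h1 s u =>
    induction s using Outer.induction with
    | h0 => rw [BalTensor.zero_tmul]
    | h2 s t hs ht => rw [BalTensor.add_tmul, hs, ht, add_zero]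
    | h1 x y =>
      induction u using Outer.induction with
      | h0 => rw [BalTensor.tmul_zero]
      | h2 s t hs ht => rw [BalTensor.tmul_add, hs, ht, add_zero]
      | h1 z w =>
        have h1 : op (z : A) • y = 0 := Subtype.ext (by
          change (y : A) * z = 0
          rw [← mul_of_mem_rightIdeal hf y.2, ← mul_of_mem_leftIdeal hf' z.2, mul_assoc,
            ← mul_assoc (y : A), ← mul_assoc, h])
        have h2 : Outer.tmul k A x (0 : RightIdeal f) = 0 := TensorProduct.tmul_zero _ x
        rw [tmul_tmul_eq k hf', h1, h2, BalTensor.zero_tmul]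

end Contraction

section Counit

variable (e : A)

/-- The multiplication `x ⊗ y ↦ x y`, as an additive map. -/
def mulOuterAdd : Outer k A A A →+ A := (LinearMap.mul' k A).toAddMonoidHom

theorem mulOuterAdd_tmul (x y : A) : mulOuterAdd k (Outer.tmul k A x y) = x * y := rfl

/-- The multiplication `x ⊗ y ↦ x y` as a homomorphism of bimodules. -/
def mulOuter : BimHom A (Outer k A A A) A where
  toLin :=
    { mulOuterAdd k with
      map_smul' := fun a t => by
        change mulOuterAdd k (a • t) = a • mulOuterAdd k t
        induction t using Outer.induction with
        | h0 => simp only [smul_zero, map_zero]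
        | h1 x y => simp [mulOuterAdd_tmul, mul_assoc]
        | h2 s t hs ht => simp only [smul_add, map_add, hs, ht] }
  map_right a t := by
    change mulOuterAdd k (op a • t) = op a • mulOuterAdd k t
    induction t using Outer.induction with
    | h0 => simp only [smul_zero, map_zero]
    | h1 x y => simp [mulOuterAdd_tmul, mul_assoc]
    | h2 s t hs ht => simp only [smul_add, map_add, hs, ht]

/-- The multiplication `A e ⊗_k e A → A`. -/
def counitIdem : BimHom A (IdemOuter k e e) A := (mulOuter k).comp (inclIdem k e e)

theorem counitIdem_tmul (x : LeftIdeal e) (y : RightIdeal e) :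
    (counitIdem k e).toLin (Outer.tmul k A x y) = x * y := rfl

/-- The evaluation of the counit of `A e ⊗_k e A` at a module. -/
def counitAt (N : Type*) [AddCommGroup N] [Module A N] : BalTensor A (IdemOuter k e e) N →ₗ[A] N :=
  unitHom N ∘ₗ BalTensor.map (counitIdem k e) LinearMap.id

theorem counitAt_tmul {N : Type*} [AddCommGroup N] [Module A N] (t : IdemOuter k e e) (n : N) :
    counitAt k e N (BalTensor.tmul A t n) = (counitIdem k e).toLin t • n := rfl

variable {e} {g : A}

/-- The inverse is `ψ`, sending `(x ⊗ w) ⊗ n` to `(x ⊗ e) ⊗ ((e ⊗ w) ⊗ n)`. The counit after `ψ` is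
the identity because `x e = x`, and `ψ` is surjective because `e A e` is spanned by `e`; so both are
bijective. -/
theorem bijective_counitAt (he : IsIdempotentElem e) (hg : IsIdempotentElem g)
    {φ : A →ₗ[k] k} (hφ : ∀ a, e * a * e = φ (e * a * e) • e)
    (N : Type*) [AddCommGroup N] [Module A N] :
    Function.Bijective (counitAt k e (BalTensor A (IdemOuter k e g) N)) := by
  let ψ : BalTensor A (IdemOuter k e g) N →ₗ[A]
      BalTensor A (IdemOuter k e e) (BalTensor A (IdemOuter k e g) N) :=
    assocInv _ _ _ ∘ₗ BalTensor.map (expandIdem k e e e g e) LinearMap.id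
  have h1 : ∀ t, counitAt k e _ (ψ t) = t := fun t => by
    induction t using BalTensor.induction with
    | h0 => simp only [map_zero]
    | h2 s t hs ht => simp only [map_add, hs, ht]
    | h1 s n =>
      induction s using Outer.induction with
      | h0 => simp only [BalTensor.zero_tmul, map_zero]
      | h2 s t hs ht => simp only [BalTensor.add_tmul, map_add, hs, ht]
      | h1 x w =>
        change counitAt k e _ (assocInv _ _ _ (BalTensor.tmul A ((expandIdem k e e e g e).toLin
          (Outer.tmul k A x w)) n)) = _
        rw [expandIdem_tmul k he hg, assocInv_tmul, counitAt_tmul, counitIdem_tmul,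
          ← BalTensor.smul_tmul, Outer.smul_tmul]
        congr 2
        refine Subtype.ext ?_
        change (x : A) * (e * e) * (1 * e) = x
        rw [one_mul, he.eq, mul_assoc, he.eq, mul_of_mem_leftIdeal he x.2]
  -- Up to associativity `ψ` is an expansion map, so the contraction by `φ` supplies a preimage of
  -- `t`.
  have h2 : ∀ t, ψ (BalTensor.map (contractIdem k e e e g φ) LinearMap.id (assocHom _ _ _ t)) =
      t := fun t => by
    rw [← assocInv_assocHom _ _ _ t]
    generalize assocHom _ _ _ t = s
    rw [assocHom_assocInv]
    change assocInv _ _ _ (BalTensor.map (expandIdem k e e e g e) LinearMap.id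
      (BalTensor.map (contractIdem k e e e g φ) LinearMap.id s)) = _
    congr 1
    induction s using BalTensor.induction with
    | h0 => simp only [map_zero]
    | h2 s t hs ht => simp only [map_add, hs, ht]
    | h1 s n =>
      rw [BalTensor.map_tmul, BalTensor.map_tmul, expandIdem_contractIdem k he he he hg
        (by rw [he.eq]; exact hφ)]
      rfl
  refine ⟨fun s t h => ?_, fun t => ⟨ψ t, h1 t⟩⟩
  rw [← h2 s, ← h2 t, h1, h1] at h
  rw [← h2 s, ← h2 t, h]

end Counit

end IdempotentBimodules

/-! ### From bimodule homomorphisms to 2-morphisms. -/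

section Realization

variable (k : Type*) [Field k] {A : Type u} [Ring A] [Algebra k A]

/-- The natural transformation of tensor functors given by a homomorphism of bimodules. -/
def tensorFunctorMap {X Y : Bimodule A} (f : BimHom A X.carrier Y.carrier) :
    tensorFunctor X ⟶ tensorFunctor Y where
  app N := ModuleCat.ofHom (BalTensor.map f LinearMap.id)
  naturality N N' g := by
    ext1
    exact BalTensor.hom_ext fun x n => rfl

theorem tensorFunctorMap_id (X : Bimodule A) :
    tensorFunctorMap (BimHom.id A X.carrier) = 𝟙 (tensorFunctor X) := by
  ext N : 2
  ext1
  exact BalTensor.hom_ext fun x n => rfl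

theorem tensorFunctorMap_comp {X Y Z : Bimodule A} (f : BimHom A X.carrier Y.carrier)
    (g : BimHom A Y.carrier Z.carrier) :
    tensorFunctorMap (g.comp f) = tensorFunctorMap f ≫ tensorFunctorMap g := by
  ext N : 2
  ext1
  exact BalTensor.hom_ext fun x n => rfl

theorem BimHom.ext_apply {X Y : Type*} [AddCommGroup X] [Module A X] [Module Aᵐᵒᵖ X]
    [AddCommGroup Y] [Module A Y] [Module Aᵐᵒᵖ Y] {f g : BimHom A X Y}
    (h : ∀ x, f.toLin x = g.toLin x) : f = g := by
  cases f; cases g; congr; exact LinearMap.ext h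

variable {𝒞 : Type u₁} [Category.{v₁} 𝒞] (E : 𝒞 ≌ FGModuleCat.{u} A)

/-- The fully faithful functor from `𝒞` to all modules. -/
abbrev toModuleCat : 𝒞 ⥤ ModuleCat.{u} A := E.functor ⋙ (ModuleCat.isFG.{u} A).ι

/-- The functor `toModuleCat` is fully faithful. -/
def fullyFaithfulToModuleCat : (toModuleCat E).FullyFaithful :=
  E.fullyFaithfulFunctor.comp (ObjectProperty.fullyFaithfulι _)

/-- A 1-morphism as a functor to all modules. -/
abbrev realize : ProjTwoCat k E ⥤ (𝒞 ⥤ ModuleCat.{u} A) :=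
  (oneMorphisms k E).ι ⋙ (Functor.whiskeringRight _ _ _).obj (toModuleCat E)

/-- The 2-morphisms are the natural transformations of the realizations. -/
def fullyFaithfulRealize : (realize k E).FullyFaithful :=
  (ObjectProperty.fullyFaithfulι _).comp
    ((fullyFaithfulToModuleCat E).whiskeringRight 𝒞)

variable {k E}

/-- The 2-morphism given by a homomorphism of bimodules. -/
def homOfBimHom {G H : ProjTwoCat k E} {X Y : Bimodule A}
    (s : (realize k E).obj G ≅ toModuleCat E ⋙ tensorFunctor X)
    (t : (realize k E).obj H ≅ toModuleCat E ⋙ tensorFunctor Y)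
    (f : BimHom A X.carrier Y.carrier) : G ⟶ H :=
  (fullyFaithfulRealize k E).preimage
    (s.hom ≫ Functor.whiskerLeft (toModuleCat E) (tensorFunctorMap f) ≫ t.inv)

theorem realize_map_homOfBimHom {G H : ProjTwoCat k E} {X Y : Bimodule A}
    (s : (realize k E).obj G ≅ toModuleCat E ⋙ tensorFunctor X)
    (t : (realize k E).obj H ≅ toModuleCat E ⋙ tensorFunctor Y)
    (f : BimHom A X.carrier Y.carrier) : (realize k E).map (homOfBimHom s t f) =
      s.hom ≫ Functor.whiskerLeft (toModuleCat E) (tensorFunctorMap f) ≫ t.inv :=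
  (fullyFaithfulRealize k E).map_preimage _

theorem homOfBimHom_id {G : ProjTwoCat k E} {X : Bimodule A}
    (s : (realize k E).obj G ≅ toModuleCat E ⋙ tensorFunctor X) :
    homOfBimHom s s (BimHom.id A X.carrier) = 𝟙 G := by
  apply (fullyFaithfulRealize k E).map_injective
  rw [realize_map_homOfBimHom, tensorFunctorMap_id, CategoryTheory.Functor.map_id]
  erw [Functor.whiskerLeft_id']
  simp

theorem homOfBimHom_comp {G H K : ProjTwoCat k E} {X Y Z : Bimodule A}
    (s : (realize k E).obj G ≅ toModuleCat E ⋙ tensorFunctor X)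
    (t : (realize k E).obj H ≅ toModuleCat E ⋙ tensorFunctor Y)
    (r : (realize k E).obj K ≅ toModuleCat E ⋙ tensorFunctor Z)
    (f : BimHom A X.carrier Y.carrier) (g : BimHom A Y.carrier Z.carrier) :
    homOfBimHom s r (g.comp f) = homOfBimHom s t f ≫ homOfBimHom t r g := by
  apply (fullyFaithfulRealize k E).map_injective
  rw [Functor.map_comp, realize_map_homOfBimHom, realize_map_homOfBimHom,
    realize_map_homOfBimHom, tensorFunctorMap_comp]
  simp

theorem nonempty_iso_of_bimodule_iso {G H : ProjTwoCat k E} {X Y : Bimodule A}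
    (hG : IsTensoring E G.obj X) (hH : IsTensoring E H.obj Y)
    (f : BimHom A X.carrier Y.carrier) (g : BimHom A Y.carrier X.carrier)
    (hfg : ∀ x, g.toLin (f.toLin x) = x) (hgf : ∀ y, f.toLin (g.toLin y) = y) :
    Nonempty (G ≅ H) := by
  obtain ⟨s⟩ := hG
  obtain ⟨t⟩ := hH
  refine ⟨⟨homOfBimHom s t f, homOfBimHom t s g, ?_, ?_⟩⟩
  · rw [← homOfBimHom_comp, ← homOfBimHom_id s]
    exact congrArg _ (BimHom.ext_apply hfg)
  · rw [← homOfBimHom_comp, ← homOfBimHom_id t]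
    exact congrArg _ (BimHom.ext_apply hgf)

/-- Composites of tensor functors. -/
theorem IsTensoring.comp {G H : 𝒞 ⥤ 𝒞} {X Y : Bimodule A} (hG : IsTensoring E G X)
    (hH : IsTensoring E H Y) : IsTensoring E (G ⋙ H) ⟨BalTensor A Y.carrier X.carrier⟩ := by
  obtain ⟨e⟩ := hG
  obtain ⟨f⟩ := hH
  exact ⟨(Functor.associator _ _ _ : (G ⋙ H) ⋙ _ ≅ G ⋙ H ⋙ _) ≪≫
    Functor.isoWhiskerLeft G f ≪≫ (Functor.associator _ _ _).symm ≪≫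
    Functor.isoWhiskerRight e (tensorFunctor Y) ≪≫ Functor.associator _ _ _ ≪≫
    Functor.isoWhiskerLeft _ (tensorAssocIso Y X)⟩

theorem IsTensoring.unit : IsTensoring E (𝟭 𝒞) (⟨A⟩ : Bimodule A) :=
  ⟨Functor.leftUnitor _ ≪≫ (Functor.rightUnitor _).symm ≪≫
    Functor.isoWhiskerLeft _ tensorUnitIso.symm⟩

theorem subsingleton_balTensor_of_subsingleton (X : Type*) [AddCommGroup X] [Module A X]
    [Module Aᵐᵒᵖ X] [SMulCommClass A Aᵐᵒᵖ X] [Subsingleton X] (N : Type*) [AddCommGroup N]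
    [Module A N] : Subsingleton (BalTensor A X N) := by
  refine subsingleton_of_forall_eq 0 fun t => ?_
  induction t using BalTensor.induction with
  | h0 => rfl
  | h1 x n => rw [Subsingleton.elim x 0, BalTensor.zero_tmul]
  | h2 s t hs ht => rw [hs, ht, add_zero]

theorem sum_balTensor_map {X : Bimodule A} {ι : Type*} [Fintype ι] {Y : ι → Bimodule A}
    (f : ∀ a, BimHom A X.carrier (Y a).carrier) (g : ∀ a, BimHom A (Y a).carrier X.carrier)
    (h : ∀ x, ∑ a, (g a).toLin ((f a).toLin x) = x) (N : Type*) [AddCommGroup N] [Module A N] :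
    ∑ a, BalTensor.map ((g a).comp (f a)) (LinearMap.id : N →ₗ[A] N) = LinearMap.id := by
  refine BalTensor.hom_ext fun x n => ?_
  rw [LinearMap.sum_apply]
  change ∑ a, BalTensor.tmul A ((g a).toLin ((f a).toLin x)) n = BalTensor.tmul A x n
  conv_rhs => rw [← h x]
  exact (map_sum ((BalTensor.tmulHom A X.carrier _).flip n) _ _).symm

variable [Preadditive 𝒞]

theorem id_eq_zero_of_subsingleton {G : ProjTwoCat k E} {X : Bimodule A}
    (hG : IsTensoring E G.obj X) (hX : Subsingleton X.carrier) : 𝟙 G = 0 := by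
  obtain ⟨s⟩ := hG
  apply (fullyFaithfulRealize k E).map_injective
  ext C : 2
  have h : Subsingleton ((toModuleCat E ⋙ tensorFunctor X).obj C) :=
    subsingleton_balTensor_of_subsingleton X.carrier _
  have h0 : IsZero ((toModuleCat E ⋙ tensorFunctor X).obj C) := ModuleCat.isZero_of_subsingleton _
  exact (h0.of_iso (s.app C)).eq_of_src _ _

variable [E.functor.Additive]

/-- The realization is fully faithful and additive, so a decomposition of the identity of a bimodule
passes to the 1-morphism it represents. -/
theorem sum_homOfBimHom_comp {G : ProjTwoCat k E} {X : Bimodule A}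
    (s : (realize k E).obj G ≅ toModuleCat E ⋙ tensorFunctor X)
    {ι : Type*} [Fintype ι] {H : ι → ProjTwoCat k E} {Y : ι → Bimodule A}
    (t : ∀ a, (realize k E).obj (H a) ≅ toModuleCat E ⋙ tensorFunctor (Y a))
    (f : ∀ a, BimHom A X.carrier (Y a).carrier) (g : ∀ a, BimHom A (Y a).carrier X.carrier)
    (h : ∀ x, ∑ a, (g a).toLin ((f a).toLin x) = x) :
    ∑ a, homOfBimHom s (t a) (f a) ≫ homOfBimHom (t a) s (g a) = 𝟙 G := by
  simp only [← homOfBimHom_comp]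
  apply (fullyFaithfulRealize k E).map_injective
  have key : ∑ a, Functor.whiskerLeft (toModuleCat E) (tensorFunctorMap ((g a).comp (f a))) =
      𝟙 (toModuleCat E ⋙ tensorFunctor X) := by
    ext C : 2
    rw [NatTrans.app_sum]
    ext1
    rw [ModuleCat.hom_sum]
    exact sum_balTensor_map f g h _
  rw [Functor.map_sum]
  simp only [realize_map_homOfBimHom]
  rw [← Preadditive.comp_sum, ← Preadditive.sum_comp, key, Category.id_comp, Iso.hom_inv_id,
    CategoryTheory.Functor.map_id]

/-- If the identity of `G` vanished, evaluation at the regular module would give `X ⊗_A A = 0`; but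
`x ⊗ 1` has the non-zero image `f x` in `A`. -/
theorem id_ne_zero_of_bimHom {G : ProjTwoCat k E} {X : Bimodule A}
    (hG : IsTensoring E G.obj X) (f : BimHom A X.carrier A) {x : X.carrier}
    (hx : f.toLin x ≠ 0) : 𝟙 G ≠ 0 := by
  obtain ⟨s⟩ := hG
  intro h
  let C := E.inverse.obj (FGModuleCat.of A A)
  have h1 : 𝟙 (((realize k E).obj G).obj C) = 0 := by
    rw [← NatTrans.id_app, ← CategoryTheory.Functor.map_id, h, Functor.map_zero]
    rfl
  have h2 := ((IsZero.iff_id_eq_zero _).2 h1).of_iso (s.app C).symm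
  have i : (toModuleCat E).obj C ≅ ModuleCat.of A A :=
    (ModuleCat.isFG.{u} A).ι.mapIso (E.counitIso.app (FGModuleCat.of A A))
  have h3 := h2.of_iso ((tensorFunctor X).mapIso i).symm
  have h4 : Subsingleton (BalTensor A X.carrier A) := ModuleCat.subsingleton_of_isZero h3
  refine hx ?_
  have h5 := congrArg (fun t => unitHom A (BalTensor.map f LinearMap.id t))
    (Subsingleton.elim (BalTensor.tmul A x (1 : A)) 0)
  simpa [unitHom] using h5

/-- `ε` realizes the multiplication `A e ⊗ e A → A`. The component of `H ◁ ε` at `C` is `ε` at `H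
C`, whose module is `(A e ⊗ g A) ⊗_A C`, and there `bijective_counitAt` applies. -/
theorem exists_counit_isIso [Module.Finite k A] {e : A} (he : IsIdempotentElem e)
    {φ : A →ₗ[k] k} (hφ : ∀ a, e * a * e = φ (e * a * e) • e) {G : ProjTwoCat k E}
    (hG : IsTensoring E G.obj (outer k A (LeftIdeal e) (RightIdeal e))) :
    ∃ ε : G ⟶ 𝟙_ (ProjTwoCat k E), ∀ (H : ProjTwoCat k E) (g : A), IsIdempotentElem g →
      IsTensoring E H.obj (outer k A (LeftIdeal e) (RightIdeal g)) → IsIso (H ◁ ε) := by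
  obtain ⟨s⟩ := hG
  let μ : tensorFunctor (outer k A (LeftIdeal e) (RightIdeal e)) ⟶ 𝟭 (ModuleCat.{u} A) :=
    tensorFunctorMap (Y := ⟨A⟩) (counitIdem k e) ≫ tensorUnitIso.hom
  let ε' : (realize k E).obj G ⟶ (realize k E).obj (𝟙_ (ProjTwoCat k E)) :=
    s.hom ≫ Functor.whiskerLeft (toModuleCat E) μ
  refine ⟨(fullyFaithfulRealize k E).preimage ε', fun H g hg hH => ?_⟩
  obtain ⟨t⟩ := hH
  have hμ : ∀ C : 𝒞, IsIso (μ.app ((toModuleCat E).obj (H.obj.obj C))) := fun C => by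
    -- Invertibility of a component depends only on the isomorphism class of the object, so `H C`
    -- may be replaced by its tensor product description.
    refine (NatTrans.isIso_app_iff_of_iso μ (t.app C)).2 ?_
    rw [ConcreteCategory.isIso_iff_bijective]
    exact bijective_counitAt k he hg hφ _
  have hε : ∀ C : 𝒞, IsIso (ε'.app (H.obj.obj C)) := fun C => by
    have := hμ C
    change IsIso (s.hom.app (H.obj.obj C) ≫ μ.app ((toModuleCat E).obj (H.obj.obj C)))
    infer_instance
  have h1 : ∀ C : 𝒞, IsIso (((fullyFaithfulRealize k E).preimage ε').hom.app (H.obj.obj C)) :=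
    fun C => by
      have h2 : (toModuleCat E).map
          (((fullyFaithfulRealize k E).preimage ε').hom.app (H.obj.obj C)) =
          ε'.app (H.obj.obj C) :=
        congrArg (fun η => η.app (H.obj.obj C)) ((fullyFaithfulRealize k E).map_preimage ε')
      have h3 : IsIso ((toModuleCat E).map
          (((fullyFaithfulRealize k E).preimage ε').hom.app (H.obj.obj C))) := h2 ▸ hε C
      exact (fullyFaithfulToModuleCat E).isIso_of_isIso_map _
  have h4 : IsIso ((oneMorphisms k E).ι.map (H ◁ (fullyFaithfulRealize k E).preimage ε')) := by
    rw [NatTrans.isIso_iff_isIso_app]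
    exact h1
  exact (ObjectProperty.fullyFaithfulι _).isIso_of_isIso_map _

/-- The identity of a 1-morphism decomposes through the identity and the 1-morphisms given by
idempotents. -/
theorem exists_sum_eq_id [Module.Finite k A] {m : ℕ} {e : Fin m → A} (he : ∑ i, e i = 1)
    {F : Fin m → Fin m → ProjTwoCat k E}
    (hF : ∀ i j, IsTensoring E (F i j).obj (outer k A (LeftIdeal (e i)) (RightIdeal (e j))))
    (G : ProjTwoCat k E) :
    ∃ (ι : Type) (_ : Fintype ι) (H : ι → ProjTwoCat k E) (f : ∀ a, G ⟶ H a)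
      (g : ∀ a, H a ⟶ G), (∀ a, H a = 𝟙_ _ ∨ ∃ i j, H a = F i j) ∧ ∑ a, f a ≫ g a = 𝟙 G := by
  obtain ⟨X, hX, ⟨s⟩⟩ := G.property
  obtain ⟨n, f, g, f', g', h⟩ := hX.decomp
  -- For each `l`, the index `none` stands for the summand `A`, and `some p` for the part of the
  -- summand `A ⊗_k A` cut out by the pair `p` of idempotents.
  let H : Fin n × Option (Fin m × Fin m) → ProjTwoCat k E := fun a =>
    a.2.elim (𝟙_ _) fun p => F p.1 p.2
  let Y : Fin n × Option (Fin m × Fin m) → Bimodule A := fun a =>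
    a.2.elim ⟨A⟩ fun p => outer k A (LeftIdeal (e p.1)) (RightIdeal (e p.2))
  have t : ∀ a, IsTensoring E (H a).obj (Y a) := by
    rintro ⟨l, _ | p⟩
    · exact IsTensoring.unit
    · exact hF p.1 p.2
  let f₁ : ∀ a, BimHom A X.carrier (Y a).carrier := fun a =>
    match a with
    | (l, none) => f l
    | (l, some p) => (projIdem k (e p.1) (e p.2)).comp (f' l)
  let g₁ : ∀ a, BimHom A (Y a).carrier X.carrier := fun a =>
    match a with
    | (l, none) => g l
    | (l, some p) => (g' l).comp (inclIdem k (e p.1) (e p.2))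
  refine ⟨_, inferInstance, H, fun a => homOfBimHom s (t a).some (f₁ a),
    fun a => homOfBimHom (t a).some s (g₁ a), ?_, sum_homOfBimHom_comp s _ f₁ g₁ fun x => ?_⟩
  · rintro ⟨l, _ | p⟩
    · exact .inl rfl
    · exact .inr ⟨p.1, p.2, rfl⟩
  · rw [Fintype.sum_prod_type]
    conv_rhs => rw [← h x]
    refine Finset.sum_congr rfl fun l _ => ?_
    rw [Fintype.sum_option]
    congr 1
    conv_rhs => rw [← sum_inclIdem_projIdem k e he ((f' l).toLin x), map_sum]
    rfl

end Realization

/-! ### Verification for the path algebra of `1 → 2 → 3` modulo `βα = 0`. -/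

namespace QuiverAlg

variable (k : Type u) [Field k]

theorem isIdempotentElem_e (i : Fin 3) : IsIdempotentElem (e k i) := by
  fin_cases i <;> ext <;> simp [e]

theorem sum_e : ∑ i, e k i = 1 := by
  rw [Fin.sum_univ_three]
  ext <;> simp [e]

theorem e_mul_mul_e_eq_zero {j s : Fin 3} (h : cartan j s = 0) (a : QuiverAlg k) :
    e k j * a * e k s = 0 := by
  fin_cases j <;> fin_cases s <;> simp [cartan] at h <;> ext <;> simp [e]

theorem exists_linear_form (p : QuiverAlg k → k) (hadd : ∀ x y, p (x + y) = p x + p y)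
    (hsmul : ∀ (r : k) x, p (r • x) = r * p x) :
    ∃ φ : QuiverAlg k →ₗ[k] k, ∀ x, φ x = p x :=
  ⟨⟨⟨p, hadd⟩, hsmul⟩, fun _ => rfl⟩

/-- Each non-zero `e_j A e_s` is a line, spanned by `e_j` if `j = s` and otherwise by one of the
arrows `α`, `β`; `φ` reads off the corresponding coordinate. The relation `βα = 0` is what excludes
the pair `(2, 0)`. -/
theorem exists_generator {j s : Fin 3} (h : cartan j s = 1) :
    ∃ (φ : QuiverAlg k →ₗ[k] k) (c : QuiverAlg k), φ (e k j * c * e k s) = 1 ∧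
      ∀ a, e k j * a * e k s = φ (e k j * a * e k s) • (e k j * c) := by
  fin_cases j <;> fin_cases s <;> simp [cartan] at h
  · obtain ⟨φ, hφ⟩ := exists_linear_form k c₁ (fun _ _ => rfl) (fun _ _ => rfl)
    exact ⟨φ, e k 0, by rw [hφ]; simp [e], fun a => by rw [hφ]; ext <;> simp [e]⟩
  · obtain ⟨φ, hφ⟩ := exists_linear_form k cα (fun _ _ => rfl) (fun _ _ => rfl)
    exact ⟨φ, ⟨0, 0, 0, 1, 0⟩, by rw [hφ]; simp [e], fun a => by rw [hφ]; ext <;> simp [e]⟩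
  · obtain ⟨φ, hφ⟩ := exists_linear_form k c₂ (fun _ _ => rfl) (fun _ _ => rfl)
    exact ⟨φ, e k 1, by rw [hφ]; simp [e], fun a => by rw [hφ]; ext <;> simp [e]⟩
  · obtain ⟨φ, hφ⟩ := exists_linear_form k cβ (fun _ _ => rfl) (fun _ _ => rfl)
    exact ⟨φ, ⟨0, 0, 0, 0, 1⟩, by rw [hφ]; simp [e], fun a => by rw [hφ]; ext <;> simp [e]⟩
  · obtain ⟨φ, hφ⟩ := exists_linear_form k c₃ (fun _ _ => rfl) (fun _ _ => rfl)
    exact ⟨φ, e k 2, by rw [hφ]; simp [e], fun a => by rw [hφ]; ext <;> simp [e]⟩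

/-- The quiver has no oriented cycles, so `e_i A e_i` is the line through `e_i`; this is the
condition that makes the counit invertible on the values of the `F_il`. -/
theorem exists_corner_form (i : Fin 3) : ∃ φ : QuiverAlg k →ₗ[k] k,
    ∀ a, e k i * a * e k i = φ (e k i * a * e k i) • e k i := by
  fin_cases i
  · obtain ⟨φ, hφ⟩ := exists_linear_form k c₁ (fun _ _ => rfl) (fun _ _ => rfl)
    exact ⟨φ, fun a => by rw [hφ]; ext <;> simp [e]⟩
  · obtain ⟨φ, hφ⟩ := exists_linear_form k c₂ (fun _ _ => rfl) (fun _ _ => rfl)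
    exact ⟨φ, fun a => by rw [hφ]; ext <;> simp [e]⟩
  · obtain ⟨φ, hφ⟩ := exists_linear_form k c₃ (fun _ _ => rfl) (fun _ _ => rfl)
    exact ⟨φ, fun a => by rw [hφ]; ext <;> simp [e]⟩

variable {k} {𝒞 : Type u₁} [Category.{v₁} 𝒞] [Preadditive 𝒞]
variable {E : 𝒞 ≌ FGModuleCat.{u} (QuiverAlg k)} [E.functor.Additive]

theorem isCellSystem {F : Fin 3 → Fin 3 → ProjTwoCat k E}
    (hF : ∀ i j, IsTensoring E (F i j).obj (bimodule k i j)) : IsCellSystem F where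
  comp_iso s l i j h := by
    obtain ⟨φ, c, h1, h2⟩ := exists_generator k h
    exact nonempty_iso_of_bimodule_iso (G := F s l ⊗ F i j)
      ((hF s l).comp (hF i j) :) (hF i l)
      (contractIdem k (e k i) (e k j) (e k s) (e k l) φ)
      (expandIdem k (e k i) (e k j) (e k s) (e k l) c)
      (expandIdem_contractIdem k (isIdempotentElem_e k _) (isIdempotentElem_e k _)
        (isIdempotentElem_e k _) (isIdempotentElem_e k _) h2)
      (contractIdem_expandIdem k (isIdempotentElem_e k _) (isIdempotentElem_e k _) h1)
  comp_zero s l i j h := by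
    have h0 := subsingleton_balTensor k (e := e k i) (g := e k l) (isIdempotentElem_e k j)
      (isIdempotentElem_e k s) (e_mul_mul_e_eq_zero k h)
    exact id_eq_zero_of_subsingleton (G := F s l ⊗ F i j)
      (X := ⟨BalTensor _ (bimodule k i j).carrier (bimodule k s l).carrier⟩)
      ((hF s l).comp (hF i j) :) h0
  counit i := by
    obtain ⟨φ, hφ⟩ := exists_corner_form k i
    obtain ⟨ε, hε⟩ := exists_counit_isIso (isIdempotentElem_e k i) hφ (hF i i)
    exact ⟨ε, fun l => hε (F i l) (e k l) (isIdempotentElem_e k l) (hF i l)⟩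
  ne_zero := by
    -- The multiplication sends `e_0 ⊗ e_0` to `e_0`, which is not zero.
    have h : (counitIdem k (e k 0)).toLin (Outer.tmul k _
        ⟨e k 0, Submodule.mem_span_singleton_self _⟩
        ⟨e k 0, Submodule.mem_span_singleton_self _⟩) ≠ 0 := fun h => by
      have := congrArg c₁ h
      rw [counitIdem_tmul] at this
      simp [e] at this
    exact id_ne_zero_of_bimHom (hF 0 0) (counitIdem k (e k 0)) h
  generate := exists_sum_eq_id (sum_e k) hF

end QuiverAlg

end ProjFun

theorem proposition20 {k : Type u} [Field k] [IsAlgClosed k]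
    {𝒞 : Type u₁} [Category.{v₁} 𝒞] [Preadditive 𝒞] [Linear k 𝒞]
    (E : 𝒞 ≌ FGModuleCat.{u} (QuiverAlg k)) [E.functor.Additive] [E.functor.Linear k]
    {M : Type w} [Category.{v} M] [Preadditive M] [Linear k M] [HasFiniteBiproducts M]
    (hM : IsFinitary k M)
    (ρ : TwoRep k (ProjTwoCat k E) M)
    (hsimple : ρ.IsSimpleTransitive) (hfaithful : ρ.IsFaithful)
    (Fij : Fin 3 → Fin 3 → ProjTwoCat k E)
    (hFij : ∀ i j, IsTensoring E (Fij i j).obj (QuiverAlg.bimodule k i j))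
    (F : Bicone fun p : Fin 3 × Fin 3 => Fij p.1 p.2) (hF : F.IsBilimit) :
    ∀ (n : ℕ) (X : Fin n → M), IsIndecList X →
      ∃ σ : Fin 3 ≃ Fin n,
        (∀ N, ρ.HasMatrix (X ∘ σ) F.pt N ↔ N = N₁₃) ∧
        ∀ i j N, ρ.HasMatrix (X ∘ σ) (Fij i j) N ↔ N = cellMatrix i j :=
  fun _ _ hX => (QuiverAlg.isCellSystem hFij).exists_ordering ρ hM hsimple.1 hfaithful F hF hX
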